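/- Let $\sigma\ge 2$, $r\ge 1$ and $N=\sigma^r$, so that $r=\log_\sigma N$, and let $S=S[1..N]$ be a string over an alphabet of $\sigma$ characters. A *meta-character* is a string of length $r$; it is stored in one machine word as a number in $\{0,\dots,N-1\}$ written in base $\sigma$. A *meta-block* of $S[1..k]$ is a substring $S[(j-1)r+1..jr]$ with $j\ge 1$ and $jr\le k$. For a meta-character $A$ and $1\le k\le N$ let $$d_{A,k}=\min\{(l-1)\bmod r \;:\; 1\le l\le k-r+1,\ S[l..l+r-1]=A\},\qquad \min\emptyset=\infty .$$ The model of computation is the unit-cost word RAM with words of $w\ge\log_2 N$ bits; its memory consists of a constant number of registers and a constant number of arrays of words, and in addition to $\sigma$ and $r$ the program is given $w$. There is a data structure (one program for all $\sigma,r,w,S$) that receives the characters $S[1],S[2],\dots,S[N]$ one at a time and has the following properties, with absolute constants in the $O$-terms. 1. Initialization and all $N$ updates together take $O(N\log N)$ time. 2. The structure occupies $O(N\log\sigma)$ bits of space plus $O(1)$ machine words, hence $O(N\log\sigma)$ bits if $w=O(\log N)$. 3. At any time, after the first $k$ characters have been received and whatever queries have been asked before, a query with any meta-character $A$ is answered in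 $O(\log N)$ time. If $k\ge r$ (in particular, if $A$ occurs in $S[1..k]$), the answer consists of a meta-character $A'$ that is a meta-block of $S[1..k]$, hence of $S$, and an integer $d$ with $0\le d\le d_{A,k}$ and $A'[1+d..r]=A[1..r-d]$ (both sides being the empty string if $d\ge r$). -/

import Mathlib

/-! ### Unit-cost word RAM -/

namespace WordRAM

/-- Binary machine instructions on `w`-bit words. -/
inductive BinOp
  | add | sub | mul | div | mod | and | or | xor | shl | shr | lt | eq

/-- Result of a binary instruction on words `x, y < 2 ^ w`. Arithmetic is modulo `2 ^ w`;
`x / 0 = 0` and `x % 0 = x`; comparisons return `0` or `1`. -/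
def BinOp.eval (w : ℕ) : BinOp → ℕ → ℕ → ℕ
  | .add, x, y => (x + y) % 2 ^ w
  | .sub, x, y => (x + (2 ^ w - y)) % 2 ^ w
  | .mul, x, y => (x * y) % 2 ^ w
  | .div, x, y => x / y
  | .mod, x, y => x % y
  | .and, x, y => x &&& y
  | .or,  x, y => x ||| y
  | .xor, x, y => x ^^^ y
  | .shl, x, y => (x <<< y) % 2 ^ w
  | .shr, x, y => x >>> y
  | .lt,  x, y => if x < y then 1 % 2 ^ w else 0
  | .eq,  x, y => if x = y then 1 % 2 ^ w else 0

/-- Programs with `m` registers and `a` arrays. Arrays are the random access memory, divided into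
a constant number of segments; the segment of an access is fixed in the program text and the
position inside the segment is read from a register. -/
inductive Cmd (m a : ℕ)
  /-- do nothing -/
  | skip : Cmd m a
  /-- `dst := v` -/
  | const (dst : Fin m) (v : ℕ) : Cmd m a
  /-- `dst := x` -/
  | copy (dst x : Fin m) : Cmd m a
  /-- `dst := x op y` -/
  | op (o : BinOp) (dst x y : Fin m) : Cmd m a
  /-- `dst := arr[idx]` -/
  | load (dst : Fin m) (arr : Fin a) (idx : Fin m) : Cmd m a
  /-- `arr[idx] := x` -/
  | store (arr : Fin a) (idx x : Fin m) : Cmd m a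
  /-- `p; q` -/
  | seq (p q : Cmd m a) : Cmd m a
  /-- `if x ≠ 0 then p else q` -/
  | ite (x : Fin m) (p q : Cmd m a) : Cmd m a
  /-- `while x ≠ 0 do p` -/
  | loop (x : Fin m) (p : Cmd m a) : Cmd m a

/-- Contents of the registers and of the arrays. -/
@[ext]
structure State (m a : ℕ) where
  reg : Fin m → ℕ
  mem : Fin a → ℕ → ℕ

namespace State

variable {m a : ℕ}

/-- All registers and all memory cells hold `0`. -/
def zero (m a : ℕ) : State m a := ⟨fun _ => 0, fun _ _ => 0⟩

def setReg (s : State m a) (x : Fin m) (v : ℕ) : State m a :=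
  { s with reg := Function.update s.reg x v }

def setMem (s : State m a) (arr : Fin a) (i v : ℕ) : State m a :=
  { s with mem := Function.update s.mem arr (Function.update (s.mem arr) i v) }

end State

/-- `Exec w size p s t s'`: on a machine with `w`-bit words whose array `arr` consists of
`size arr` words, program `p` started in state `s` halts in state `s'` after exactly `t` unit-cost
steps. Every instruction and every test of a condition takes one step. A program that accesses an
array outside its bounds has no execution. -/
inductive Exec {m a : ℕ} (w : ℕ) (size : Fin a → ℕ) :
    Cmd m a → State m a → ℕ → State m a → Prop
  | skip (s) : Exec w size .skip s 1 s
  | const (s dst v) : Exec w size (.const dst v) s 1 (s.setReg dst (v % 2 ^ w))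
  | copy (s dst x) : Exec w size (.copy dst x) s 1 (s.setReg dst (s.reg x))
  | op (s o dst x y) :
      Exec w size (.op o dst x y) s 1 (s.setReg dst (o.eval w (s.reg x) (s.reg y)))
  | load (s dst arr idx) (h : s.reg idx < size arr) :
      Exec w size (.load dst arr idx) s 1 (s.setReg dst (s.mem arr (s.reg idx)))
  | store (s arr idx x) (h : s.reg idx < size arr) :
      Exec w size (.store arr idx x) s 1 (s.setMem arr (s.reg idx) (s.reg x))
  | seq {p q s t₁ s₁ t₂ s₂} (hp : Exec w size p s t₁ s₁) (hq : Exec w size q s₁ t₂ s₂) :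
      Exec w size (.seq p q) s (t₁ + t₂) s₂
  | ite_true {x p q s t s'} (hx : s.reg x ≠ 0) (hp : Exec w size p s t s') :
      Exec w size (.ite x p q) s (t + 1) s'
  | ite_false {x p q s t s'} (hx : s.reg x = 0) (hq : Exec w size q s t s') :
      Exec w size (.ite x p q) s (t + 1) s'
  | loop_done {x p s} (hx : s.reg x = 0) : Exec w size (.loop x p) s 1 s
  | loop_step {x p s t₁ s₁ t₂ s₂} (hx : s.reg x ≠ 0) (hp : Exec w size p s t₁ s₁)
      (hl : Exec w size (.loop x p) s₁ t₂ s₂) : Exec w size (.loop x p) s (t₁ + t₂ + 1) s₂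

/-- Executions are deterministic, so "the" final state and running time are well defined. -/
theorem Exec.deterministic {m a w : ℕ} {size : Fin a → ℕ} {p : Cmd m a} {s s₁ s₂ : State m a}
    {t₁ t₂ : ℕ} (h₁ : Exec w size p s t₁ s₁) (h₂ : Exec w size p s t₂ s₂) :
    t₁ = t₂ ∧ s₁ = s₂ := by
  induction h₁ generalizing t₂ s₂ with
  | skip | const | copy | op | load | store => cases h₂; exact ⟨rfl, rfl⟩
  | seq _ _ ihp ihq =>
    cases h₂ with
    | seq hp hq =>
      obtain ⟨rfl, rfl⟩ := ihp hp
      obtain ⟨rfl, rfl⟩ := ihq hq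
      exact ⟨rfl, rfl⟩
  | ite_true hx _ ih =>
    cases h₂ with
    | ite_true _ hp => obtain ⟨rfl, rfl⟩ := ih hp; exact ⟨rfl, rfl⟩
    | ite_false hx' _ => exact absurd hx' hx
  | ite_false hx _ ih =>
    cases h₂ with
    | ite_true hx' _ => exact absurd hx hx'
    | ite_false _ hq => obtain ⟨rfl, rfl⟩ := ih hq; exact ⟨rfl, rfl⟩
  | loop_done hx =>
    cases h₂ with
    | loop_done _ => exact ⟨rfl, rfl⟩
    | loop_step hx' _ _ => exact absurd hx hx'
  | loop_step hx _ _ ihp ihl =>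
    cases h₂ with
    | loop_done hx' => exact absurd hx' hx
    | loop_step _ hp hl =>
      obtain ⟨rfl, rfl⟩ := ihp hp
      obtain ⟨rfl, rfl⟩ := ihl hl
      exact ⟨rfl, rfl⟩

end WordRAM

/-! ### Meta-characters and meta-blocks (positions are counted from `0`) -/

namespace MetaBlock

open WordRAM

variable {σ N r : ℕ}

/-- The machine word representing a meta-character: the string of `r` characters read as a number
in base `σ`, most significant character first; it is smaller than `σ ^ r`. -/
def code (A : Fin r → Fin σ) : ℕ := ∑ i : Fin r, (A i : ℕ) * σ ^ (r - 1 - (i : ℕ))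

/-- `A` occurs in `S` starting at position `l`. -/
def OccursAt (S : Fin N → Fin σ) (A : Fin r → Fin σ) (l : ℕ) : Prop :=
  ∀ i : Fin r, ∃ h : l + (i : ℕ) < N, S ⟨l + (i : ℕ), h⟩ = A i

/-- `A` is the content of a meta-block `[j * r, (j + 1) * r)` of the length `k` prefix of `S`. -/
def IsBlock (S : Fin N → Fin σ) (k : ℕ) (A : Fin r → Fin σ) : Prop :=
  ∃ j : ℕ, (j + 1) * r ≤ k ∧ OccursAt S A (j * r)

/-- The minimal offset modulo `r` of an occurrence of `A` in the length `k` prefix of `S`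
(`⊤` if there is no occurrence). -/
noncomputable def minOffset (S : Fin N → Fin σ) (k : ℕ) (A : Fin r → Fin σ) : ℕ∞ :=
  ⨅ (l : ℕ) (_ : l + r ≤ k ∧ OccursAt S A l), ((l % r : ℕ) : ℕ∞)

/-- After its first `d` characters are removed, `A'` equals `A` without its last `d` characters. -/
def ShiftMatch (A' A : Fin r → Fin σ) (d : ℕ) : Prop :=
  ∀ i j : Fin r, (j : ℕ) = (i : ℕ) + d → A' j = A i

/-- The code of an on-line data structure: three procedures, together with the registers through
which they communicate. -/
structure OnlineStructure (m a : ℕ) where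
  /-- run once, before the first character arrives -/
  setup : Cmd m a
  /-- run when the next character of the string arrives -/
  append : Cmd m a
  /-- run to answer a query -/
  query : Cmd m a
  /-- input of `setup`: the largest character `σ - 1` -/
  maxCharReg : Fin m
  /-- input of `setup`: the length `r` of a meta-character -/
  lenReg : Fin m
  /-- input of `setup`: the word size `w` -/
  wordReg : Fin m
  /-- input of `append`: the new character -/
  charReg : Fin m
  /-- input of `query`: the meta-character -/
  argReg : Fin m
  /-- output of `query`: the meta-block -/
  blockReg : Fin m
  /-- output of `query`: the shift -/
  shiftReg : Fin m

/-- The state in which `setup` is started. -/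
def OnlineStructure.start {m a : ℕ} (D : OnlineStructure m a) (σ r w : ℕ) : State m a :=
  (((State.zero m a).setReg D.maxCharReg (σ - 1)).setReg D.lenReg r).setReg D.wordReg w

/-- `D.Reach w size r S k s T`: state `s` can arise after `setup`, the arrival of the first `k`
characters of `S` one by one, and arbitrary queries in between; `T` is the total time taken by
`setup` and the `k` updates. -/
inductive OnlineStructure.Reach {m a : ℕ} (D : OnlineStructure m a) (w : ℕ) (size : Fin a → ℕ)
    (r : ℕ) (S : Fin N → Fin σ) : ℕ → State m a → ℕ → Prop
  | setup {t s} (h : Exec w size D.setup (D.start σ r w) t s) : D.Reach w size r S 0 s t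
  | append {k s T t s'} (hs : D.Reach w size r S k s T) (hk : k < N)
      (h : Exec w size D.append (s.setReg D.charReg (S ⟨k, hk⟩ : ℕ)) t s') :
      D.Reach w size r S (k + 1) s' (T + t)
  | query {k s T t s'} (hs : D.Reach w size r S k s T) (A : Fin r → Fin σ)
      (h : Exec w size D.query (s.setReg D.argReg (code A)) t s') : D.Reach w size r S k s' T

/-- Total number of bits of a machine with `m` registers and arrays of the given sizes. -/
def spaceBits {a : ℕ} (m w : ℕ) (size : Fin a → ℕ) : ℕ := (m + ∑ i, size i) * w

end MetaBlock

/-! An occurrence of `A` at offset `d` modulo `r` starts inside some meta-block, and the last `r -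
d` characters of that meta-block are the first `r - d` characters of `A`
(`exists_block_of_occursAt`). So if `l` is the greatest length for which the prefix of `A` of length
`l` is a suffix of a meta-block seen so far, then `r - l` is at most the minimal offset. It suffices
to find this `l` and a meta-block with that suffix.

The reversed meta-blocks are kept in a trie (`IsTrie`) without pointers. A string of length `l < r`
with value `x` has address `levelOffset σ l + x`, and these addresses are distinct and below `σ ^
r`. A node stores one bit of presence and one character that precedes the string in some block; full
blocks have a separate table of bits. In numbers, a suffix of length `l` is a residue modulo `σ ^
l`, and removing the last `d` characters is division by `σ ^ d`; neighbouring levels are reached by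
arithmetic with `σ`.

A query shortens `A` from the right until the string is in the trie (`search_wp`). It then prepends
stored characters (`extendLoop_wp`): each extended string is again a suffix of a block, though
perhaps of another one, and at length `r` it is a block (`IsTrie.step`). Both phases take `O(r)`
steps, as does entering all suffixes of a new block (`insertLoop_wp`), and `r ≤ log₂ N`. There are
three tables with `N` fields of `⌈log₂ σ⌉` bits; packed into words they take `O(N log σ + w)` bits
(`spaceBits_le`). -/

namespace MetaBlock

/-! ### Packed arrays: `q` fields of `b` bits per word -/

/-- The `i`-th field of a packed array. -/
def field (b q : ℕ) (M : ℕ → ℕ) (i : ℕ) : ℕ := (M (i / q) >>> (i % q * b)) &&& (2 ^ b - 1)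

/-- Replacement of the `i`-th field of a packed array. -/
def setField (b q : ℕ) (M : ℕ → ℕ) (i c : ℕ) : ℕ → ℕ :=
  Function.update M (i / q) (M (i / q) ^^^ ((field b q M i ^^^ c) <<< (i % q * b)))

theorem field_lt (b q : ℕ) (M : ℕ → ℕ) (i : ℕ) : field b q M i < 2 ^ b := by
  rw [field, Nat.and_two_pow_sub_one_eq_mod]
  exact Nat.mod_lt _ (by positivity)

theorem testBit_field (b q : ℕ) (M : ℕ → ℕ) (i n : ℕ) :
    (field b q M i).testBit n = (decide (n < b) && (M (i / q)).testBit (i % q * b + n)) := by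
  rw [field, Nat.testBit_and, Nat.testBit_shiftRight, Nat.testBit_two_pow_sub_one, Bool.and_comm]

theorem field_zero (b q i : ℕ) : field b q (fun _ => 0) i = 0 := by
  simp [field]

/-- XOR with (old value XOR new value) cancels the old field and leaves the new one. The bound on
`c` matters because reading truncates to `b` bits. -/
theorem field_setField_self {b q c : ℕ} (M : ℕ → ℕ) (i : ℕ) (hc : c < 2 ^ b) :
    field b q (setField b q M i c) i = c := by
  apply Nat.eq_of_testBit_eq
  intro n
  rw [testBit_field]
  by_cases hn : n < b
  · simp [setField, testBit_field, hn]
  · have : c.testBit n = false :=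
      Nat.testBit_lt_two_pow (hc.trans_le (Nat.pow_le_pow_right (by norm_num) (by omega)))
    simp [hn, this]

/-- The XOR pattern has at most `b` bits, so it is confined to slot `i % q` of one word; different
slots of a word occupy disjoint bit ranges. -/
theorem field_setField_of_ne {b q c i j : ℕ} (M : ℕ → ℕ) (hc : c < 2 ^ b) (hij : j ≠ i) :
    field b q (setField b q M i c) j = field b q M j := by
  apply Nat.eq_of_testBit_eq
  intro n
  rw [testBit_field, testBit_field]
  by_cases hd : j / q = i / q
  · by_cases hn : n < b
    · have hm : j % q ≠ i % q := by
        intro hm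
        apply hij
        rw [← Nat.div_add_mod j q, ← Nat.div_add_mod i q, hd, hm]
      rcases lt_or_gt_of_ne hm with hlt | hgt
      · have h1 : (j % q + 1) * b ≤ i % q * b := Nat.mul_le_mul_right _ hlt
        have h2 : ¬ i % q * b ≤ j % q * b + n := by rw [add_mul] at h1; omega
        simp [setField, hd, h2]
      · have h1 : (i % q + 1) * b ≤ j % q * b := Nat.mul_le_mul_right _ hgt
        have h2 : b ≤ j % q * b + n - i % q * b := by rw [add_mul] at h1; omega
        have h3 : (field b q M i ^^^ c).testBit (j % q * b + n - i % q * b) = false :=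
          Nat.testBit_lt_two_pow ((Nat.xor_lt_two_pow (field_lt b q M i) hc).trans_le
            (Nat.pow_le_pow_right (by norm_num) h2))
        rw [Nat.testBit_xor] at h3
        simp [setField, hd, h3]
    · simp [hn]
  · simp [setField, Function.update_of_ne hd]

theorem field_setField {b q c : ℕ} (M : ℕ → ℕ) (i j : ℕ) (hc : c < 2 ^ b) :
    field b q (setField b q M i c) j = if j = i then c else field b q M j := by
  split_ifs with h
  · rw [h, field_setField_self M i hc]
  · exact field_setField_of_ne M hc h

/-! ### Numbering of the strings of length less than `r` -/

/-- The number of strings of length less than `l`: the position of the first string of length `l`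
in the enumeration by length and value. -/
def levelOffset (σ l : ℕ) : ℕ := ∑ i ∈ Finset.range l, σ ^ i

theorem levelOffset_succ (σ l : ℕ) : levelOffset σ (l + 1) = levelOffset σ l + σ ^ l :=
  Finset.sum_range_succ _ _

theorem levelOffset_succ' (σ l : ℕ) : levelOffset σ (l + 1) = levelOffset σ l * σ + 1 := by
  rw [levelOffset, geom_sum_succ, mul_comm]; rfl

/-- Horner's rule `levelOffset σ (l + 1) = levelOffset σ l * σ + 1` can be undone by division since
`1 / σ = 0`. The programs thus change level in constant time without a table of offsets. -/
theorem levelOffset_div {σ : ℕ} (hσ : 2 ≤ σ) (l : ℕ) :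
    levelOffset σ (l + 1) / σ = levelOffset σ l := by
  rw [levelOffset_succ', mul_comm, Nat.mul_add_div (by omega), Nat.div_eq_of_lt (by omega),
    add_zero]

theorem levelOffset_mono (σ : ℕ) : Monotone (levelOffset σ) :=
  monotone_nat_of_le_succ fun l => by rw [levelOffset_succ]; omega

theorem levelOffset_lt_pow {σ : ℕ} (hσ : 2 ≤ σ) (l : ℕ) : levelOffset σ l < σ ^ l := by
  induction l with
  | zero => simp [levelOffset]
  | succ l ih => rw [levelOffset_succ, pow_succ]; nlinarith

/-- All levels below `r` together have fewer than `σ ^ r` strings, so the node tables need no more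
fields than the leaf table. -/
theorem levelOffset_add_lt {σ r l x : ℕ} (hσ : 2 ≤ σ) (hl : l < r) (hx : x < σ ^ l) :
    levelOffset σ l + x < σ ^ r := by
  have h1 := levelOffset_lt_pow hσ (l + 1)
  have h2 : σ ^ (l + 1) ≤ σ ^ r := Nat.pow_le_pow_right (by omega) hl
  rw [levelOffset_succ] at h1
  omega

/-- The levels occupy disjoint consecutive intervals of addresses. -/
theorem levelOffset_add_inj {σ l l' x x' : ℕ} (hx : x < σ ^ l) (hx' : x' < σ ^ l')
    (h : levelOffset σ l + x = levelOffset σ l' + x') : l = l' ∧ x = x' := by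
  have hl : l = l' := by
    rcases lt_trichotomy l l' with hlt | heq | hgt
    · have := levelOffset_mono σ (Nat.succ_le_of_lt hlt)
      rw [Nat.succ_eq_add_one, levelOffset_succ] at this
      omega
    · exact heq
    · have := levelOffset_mono σ (Nat.succ_le_of_lt hgt)
      rw [Nat.succ_eq_add_one, levelOffset_succ] at this
      omega
  subst hl
  exact ⟨rfl, by omega⟩

/-! ### Codes of strings -/

/-- The number with base `σ` digits `f 0, …, f (n - 1)`, most significant digit first. -/
def prefixCode (σ : ℕ) (f : ℕ → ℕ) : ℕ → ℕ
  | 0 => 0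
  | n + 1 => prefixCode σ f n * σ + f n

theorem prefixCode_lt {σ : ℕ} {f : ℕ → ℕ} (n : ℕ) (hf : ∀ i < n, f i < σ) :
    prefixCode σ f n < σ ^ n := by
  induction n with
  | zero => simp [prefixCode]
  | succ n ih =>
    have h1 := ih fun i hi => hf i (by omega)
    have h2 := hf n (by omega)
    rw [prefixCode, pow_succ]
    nlinarith

theorem prefixCode_eq_sum (σ : ℕ) (f : ℕ → ℕ) (n : ℕ) :
    prefixCode σ f n = ∑ i ∈ Finset.range n, f i * σ ^ (n - 1 - i) := by
  induction n with
  | zero => simp [prefixCode]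
  | succ n ih =>
    rw [prefixCode, ih, Finset.sum_range_succ, Finset.sum_mul]
    simp only [Nat.add_sub_cancel, Nat.sub_self, pow_zero, mul_one]
    congr 1
    refine Finset.sum_congr rfl fun i hi => ?_
    rw [Finset.mem_range] at hi
    rw [mul_assoc, ← pow_succ]
    congr 2
    omega

theorem prefixCode_div_mod {σ : ℕ} {f : ℕ → ℕ} (n e : ℕ) (he : e < n) (hf : ∀ i < n, f i < σ) :
    prefixCode σ f n / σ ^ e % σ = f (n - 1 - e) := by
  induction n generalizing e with
  | zero => omega
  | succ n ih =>
    have h2 := hf n (by omega)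
    cases e with
    | zero =>
      rw [prefixCode, pow_zero, Nat.div_one, Nat.mul_add_mod', Nat.mod_eq_of_lt h2]
      simp
    | succ e =>
      have h3 : (prefixCode σ f n * σ + f n) / σ = prefixCode σ f n := by
        rw [mul_comm, Nat.mul_add_div (by omega), Nat.div_eq_of_lt h2, add_zero]
      rw [prefixCode, pow_succ', ← Nat.div_div_eq_div_mul, h3,
        ih e (by omega) fun i hi => hf i (by omega)]
      congr 1
      omega

theorem eq_of_digits_eq {σ : ℕ} (n : ℕ) {x y : ℕ} (hx : x < σ ^ n) (hy : y < σ ^ n)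
    (h : ∀ e < n, x / σ ^ e % σ = y / σ ^ e % σ) : x = y := by
  induction n generalizing x y with
  | zero => simp at hx hy; omega
  | succ n ih =>
    have h0 := h 0 (by omega)
    rw [pow_zero, Nat.div_one, Nat.div_one] at h0
    have h1 : x / σ = y / σ := by
      refine ih (Nat.div_lt_of_lt_mul (by rwa [← pow_succ']))
        (Nat.div_lt_of_lt_mul (by rwa [← pow_succ'])) fun e he => ?_
      rw [Nat.div_div_eq_div_mul, Nat.div_div_eq_div_mul, ← pow_succ']
      exact h (e + 1) (by omega)
    rw [← Nat.div_add_mod x σ, ← Nat.div_add_mod y σ, h0, h1]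

theorem mod_pow_div_mod (σ X : ℕ) {e n : ℕ} (he : e < n) :
    X % σ ^ n / σ ^ e % σ = X / σ ^ e % σ := by
  obtain ⟨m, rfl⟩ := Nat.exists_eq_add_of_lt he
  rw [show e + m + 1 = e + (m + 1) by omega, pow_add, Nat.mod_mul_right_div_self, pow_succ',
    Nat.mod_mul_right_mod]

theorem mod_pow_succ_eq (σ X n : ℕ) :
    X % σ ^ (n + 1) = X % σ ^ n + X / σ ^ n % σ * σ ^ n := by
  rw [pow_succ, Nat.mod_mul, mul_comm (σ ^ n)]

/-! ### Meta-characters, their digits and shifted matches -/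

variable {σ N r : ℕ}

/-- A string as a sequence of numbers, continued by `0`. -/
def charSeq (A : Fin r → Fin σ) (i : ℕ) : ℕ := if h : i < r then (A ⟨i, h⟩ : ℕ) else 0

theorem charSeq_lt (A : Fin r → Fin σ) {i : ℕ} (hi : i < r) : charSeq A i < σ := by
  simp [charSeq, hi]

theorem charSeq_fin (A : Fin r → Fin σ) (i : Fin r) : charSeq A i = (A i : ℕ) := by
  simp [charSeq]

theorem code_eq_prefixCode (A : Fin r → Fin σ) : code A = prefixCode σ (charSeq A) r := by
  rw [prefixCode_eq_sum, Finset.sum_range, code]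
  simp only [charSeq_fin]

theorem code_lt (A : Fin r → Fin σ) : code A < σ ^ r := by
  rw [code_eq_prefixCode]
  exact prefixCode_lt r fun i hi => charSeq_lt A hi

theorem code_digit (A : Fin r → Fin σ) (i : Fin r) :
    code A / σ ^ (r - 1 - (i : ℕ)) % σ = (A i : ℕ) := by
  have := i.isLt
  rw [code_eq_prefixCode, prefixCode_div_mod r _ (by omega) fun i hi => charSeq_lt A hi,
    ← charSeq_fin]
  congr 1
  omega

/-- Dropping the first `d` characters is reduction modulo `σ ^ (r - d)`, and dropping the last `d`
is division by `σ ^ d`; the digits are then compared. For `d ≥ r` there is nothing to compare. -/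
theorem shiftMatch_of_code {A' A : Fin r → Fin σ} {d : ℕ}
    (h : code A' % σ ^ (r - d) = code A / σ ^ d) : ShiftMatch A' A d := by
  intro i j hij
  have hi := i.isLt
  have hj := j.isLt
  apply Fin.ext
  rw [← code_digit A' j, ← code_digit A i, ← mod_pow_div_mod σ (code A') (n := r - d) (by omega), h,
    Nat.div_div_eq_div_mul, ← pow_add]
  congr 3
  omega

theorem code_of_shiftMatch {A' A : Fin r → Fin σ} {d : ℕ} (hσ : 0 < σ) (hd : d ≤ r)
    (h : ShiftMatch A' A d) : code A' % σ ^ (r - d) = code A / σ ^ d := by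
  refine eq_of_digits_eq (r - d) (Nat.mod_lt _ (by positivity)) ?_ fun e he => ?_
  · apply Nat.div_lt_of_lt_mul
    rw [← pow_add, show d + (r - d) = r by omega]
    exact code_lt A
  · have hj : r - 1 - e < r := by omega
    have hi : r - 1 - e - d < r := by omega
    have h1 := code_digit A' ⟨r - 1 - e, hj⟩
    have h2 := code_digit A ⟨r - 1 - e - d, hi⟩
    have h3 := h ⟨r - 1 - e - d, hi⟩ ⟨r - 1 - e, hj⟩ (by simp only; omega)
    rw [h3, ← h2] at h1
    simp only at h1
    rw [show r - 1 - (r - 1 - e) = e by omega,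
      show r - 1 - (r - 1 - e - d) = d + e by omega] at h1
    rw [mod_pow_div_mod σ _ he, h1, Nat.div_div_eq_div_mul, pow_add]

/-! ### The codes of the meta-blocks -/

/-- The codes of the meta-blocks of the length `k` prefix of `S`. -/
def blockCodes (r : ℕ) (S : Fin N → Fin σ) (k : ℕ) : Set ℕ :=
  {X | ∃ A : Fin r → Fin σ, IsBlock S k A ∧ X = code A}

theorem blockCodes_lt {S : Fin N → Fin σ} {k X : ℕ} (h : X ∈ blockCodes r S k) : X < σ ^ r := by
  obtain ⟨A, -, rfl⟩ := h
  exact code_lt A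

theorem exists_occursAt (S : Fin N → Fin σ) {l : ℕ} (h : l + r ≤ N) :
    ∃ A : Fin r → Fin σ, OccursAt S A l :=
  ⟨fun i => S ⟨l + i, by omega⟩, fun i => ⟨by omega, rfl⟩⟩

theorem OccursAt.code_eq {S : Fin N → Fin σ} {A : Fin r → Fin σ} {l : ℕ} (h : OccursAt S A l) :
    code A = prefixCode σ (fun i => charSeq S (l + i)) r := by
  rw [code_eq_prefixCode, prefixCode_eq_sum, prefixCode_eq_sum]
  refine Finset.sum_congr rfl fun i hi => ?_
  rw [Finset.mem_range] at hi
  obtain ⟨h1, h2⟩ := h ⟨i, hi⟩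
  simp only at h1 h2
  simp [charSeq, hi, h1, h2]

theorem blockCodes_eq (S : Fin N → Fin σ) {k : ℕ} (hk : k ≤ N) :
    blockCodes r S k =
      {X | ∃ j, (j + 1) * r ≤ k ∧ X = prefixCode σ (fun i => charSeq S (j * r + i)) r} := by
  ext X
  constructor
  · rintro ⟨A, ⟨j, hj, hA⟩, rfl⟩
    exact ⟨j, hj, hA.code_eq⟩
  · rintro ⟨j, hj, rfl⟩
    obtain ⟨A, hA⟩ := exists_occursAt (r := r) S (l := j * r) (by rw [add_mul] at hj; omega)
    exact ⟨A, ⟨j, hj, hA⟩, hA.code_eq.symm⟩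

theorem blockCodes_of_lt (S : Fin N → Fin σ) {k : ℕ} (hk : k < r) : blockCodes r S k = ∅ := by
  ext X
  simp only [Set.mem_empty_iff_false, iff_false]
  rintro ⟨A, ⟨j, hj, -⟩, -⟩
  rw [add_mul] at hj
  omega

theorem blockCodes_nonempty (S : Fin N → Fin σ) {k : ℕ} (hk : k ≤ N) (hr : r ≤ k) :
    (blockCodes r S k).Nonempty := by
  rw [blockCodes_eq S hk]
  exact ⟨_, 0, by omega, rfl⟩

/-- A new meta-block would have to end at `k + 1`, which is not a multiple of `r`. -/
theorem blockCodes_succ_of_lt (S : Fin N → Fin σ) {k : ℕ} (hk : k < N) (hr : k % r + 1 < r) :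
    blockCodes r S (k + 1) = blockCodes r S k := by
  rw [blockCodes_eq S hk, blockCodes_eq S hk.le]
  ext X
  simp only [Set.mem_ofPred_eq]
  refine exists_congr fun j => and_congr_left fun _ => ⟨fun h => ?_, fun h => by omega⟩
  by_contra hlt
  have h1 : k + 1 = (j + 1) * r := by omega
  have h2 : (k + 1) % r = k % r + 1 := by
    rw [Nat.add_mod, Nat.mod_eq_of_lt (a := 1) (by omega), Nat.mod_eq_of_lt hr]
  rw [h1, Nat.mul_mod_left] at h2
  omega

theorem blockCodes_succ_of_eq (S : Fin N → Fin σ) {k : ℕ} (hk : k < N) (hr : k % r + 1 = r) :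
    blockCodes r S (k + 1) =
      insert (prefixCode σ (fun i => charSeq S (k / r * r + i)) r) (blockCodes r S k) := by
  have h0 : k + 1 = (k / r + 1) * r := by
    have := Nat.div_add_mod' k r
    rw [add_mul]; omega
  rw [blockCodes_eq S hk, blockCodes_eq S hk.le]
  ext X
  simp only [Set.mem_ofPred_eq, Set.mem_insert_iff]
  constructor
  · rintro ⟨j, hj, rfl⟩
    rcases Nat.lt_or_ge k ((j + 1) * r) with hlt | hge
    · left
      have h1 : (j + 1) * r = (k / r + 1) * r := by omega
      have h2 := Nat.eq_of_mul_eq_mul_right (by omega) h1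
      rw [show j = k / r by omega]
    · exact Or.inr ⟨j, hge, rfl⟩
  · rintro (rfl | ⟨j, hj, rfl⟩)
    · exact ⟨k / r, h0.ge, rfl⟩
    · exact ⟨j, by omega, rfl⟩

/-- An occurrence of `A` at offset `d` modulo `r` makes a meta-block match `A` shifted by `d`. -/
theorem exists_block_of_occursAt (hσ : 0 < σ) (hr : 0 < r) {S : Fin N → Fin σ} {k l : ℕ}
    {A : Fin r → Fin σ} (hk : k ≤ N) (hl : l + r ≤ k) (hA : OccursAt S A l) :
    ∃ X ∈ blockCodes r S k, X % σ ^ (r - l % r) = code A / σ ^ (l % r) := by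
  have h0 := Nat.div_add_mod' l r
  have hlt := Nat.mod_lt l hr
  obtain ⟨B, hB⟩ := exists_occursAt (r := r) S (l := l / r * r) (by omega)
  refine ⟨code B, ⟨B, ⟨l / r, by rw [add_mul]; omega, hB⟩, rfl⟩, ?_⟩
  refine code_of_shiftMatch hσ hlt.le fun i j hij => ?_
  obtain ⟨h1, h2⟩ := hA i
  obtain ⟨h3, h4⟩ := hB j
  rw [← h2, ← h4]
  congr 2
  omega

/-! ### The trie of reversed meta-blocks -/

/-- Contents of the three tables when the blocks with codes in `B` are stored: `leaf X` tells
whether `X ∈ B`; `node` tells whether a string of length `l < r` is known to be a suffix of a block,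
and then `char` is the preceding character in such a block. `D X l` expresses that the suffix of
length `l` of the block `X` has been entered. -/
structure IsTrie (σ r : ℕ) (leaf node char : ℕ → ℕ) (B : Set ℕ) (D : ℕ → ℕ → Prop) : Prop where
  leaf_iff : ∀ X < σ ^ r, leaf X ≠ 0 ↔ X ∈ B
  char_lt : ∀ i, char i < σ
  node_ne : ∀ X l, l < r → D X l → node (levelOffset σ l + X % σ ^ l) ≠ 0
  exists_block : ∀ l x, l < r → x < σ ^ l → node (levelOffset σ l + x) ≠ 0 →
    ∃ X ∈ B, X % σ ^ l = x ∧ X / σ ^ l % σ = char (levelOffset σ l + x)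

theorem IsTrie.mono {leaf node char : ℕ → ℕ} {B : Set ℕ} {D D' : ℕ → ℕ → Prop}
    (h : IsTrie σ r leaf node char B D) (hD : ∀ X l, l < r → D' X l → D X l) :
    IsTrie σ r leaf node char B D' :=
  ⟨h.leaf_iff, h.char_lt, fun X l hl hX => h.node_ne X l hl (hD X l hl hX), h.exists_block⟩

/-- Witnesses for nodes survive when `B` grows. `D` is separate from `B` because the suffixes of the
new block are not yet entered at this point. -/
theorem IsTrie.insert_leaf {leaf node char : ℕ → ℕ} {B : Set ℕ} {D : ℕ → ℕ → Prop}
    (h : IsTrie σ r leaf node char B D) (X : ℕ) :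
    IsTrie σ r (fun j => if j = X then 1 else leaf j) node char (insert X B) D where
  leaf_iff := by
    intro Y hY
    by_cases hXY : Y = X
    · simp [hXY]
    · simp [hXY, h.leaf_iff Y hY]
  char_lt := h.char_lt
  node_ne := h.node_ne
  exists_block := by
    intro l x hl hx hne
    obtain ⟨Y, hY, h1⟩ := h.exists_block l x hl hx hne
    exact ⟨Y, Or.inr hY, h1⟩

/-- Overwriting the character of an existing node is harmless: any one block with this suffix can
serve as the witness. Injectivity of addresses protects the other nodes. -/
theorem IsTrie.insert_node {leaf node char : ℕ → ℕ} {B : Set ℕ} {D : ℕ → ℕ → Prop}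
    (h : IsTrie σ r leaf node char B D) (hσ : 0 < σ) {X n : ℕ} (hX : X ∈ B) :
    IsTrie σ r leaf
      (fun j => if j = levelOffset σ n + X % σ ^ n then 1 else node j)
      (fun j => if j = levelOffset σ n + X % σ ^ n then X / σ ^ n % σ else char j) B
      (fun Y l => D Y l ∨ Y = X ∧ l = n) where
  leaf_iff := h.leaf_iff
  char_lt := by
    intro i
    split_ifs
    · exact Nat.mod_lt _ hσ
    · exact h.char_lt i
  node_ne := by
    rintro Y l hl (hD | ⟨rfl, rfl⟩)
    · split_ifs
      · exact one_ne_zero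
      · exact h.node_ne Y l hl hD
    · simp
  exists_block := by
    intro l x hl hx hne
    split_ifs at hne ⊢ with heq
    · obtain ⟨rfl, rfl⟩ := levelOffset_add_inj hx (Nat.mod_lt _ (by positivity)) heq
      exact ⟨X, hX, rfl, rfl⟩
    · exact h.exists_block l x hl hx hne

/-- Walking one level down in the trie. -/
theorem IsTrie.step {leaf node char : ℕ → ℕ} {B : Set ℕ}
    (h : IsTrie σ r leaf node char B fun X _ => X ∈ B) {l x : ℕ} (hl : l < r) (hx : x < σ ^ l)
    (hB : ∃ X ∈ B, X % σ ^ l = x) :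
    ∃ X ∈ B, X % σ ^ (l + 1) = x + char (levelOffset σ l + x) * σ ^ l := by
  obtain ⟨Y, hY, hYx⟩ := hB
  have h1 := h.node_ne Y l hl hY
  rw [hYx] at h1
  obtain ⟨X, hX, h2, h3⟩ := h.exists_block l x hl hx h1
  exact ⟨X, hX, by rw [mod_pow_succ_eq, h2, h3]⟩

theorem IsTrie.node_ne_iff {leaf node char : ℕ → ℕ} {B : Set ℕ}
    (h : IsTrie σ r leaf node char B fun X _ => X ∈ B) {l x : ℕ} (hl : l < r) (hx : x < σ ^ l) :
    node (levelOffset σ l + x) ≠ 0 ↔ ∃ X ∈ B, X % σ ^ l = x := by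
  constructor
  · intro hne
    obtain ⟨X, hX, h1, -⟩ := h.exists_block l x hl hx hne
    exact ⟨X, hX, h1⟩
  · rintro ⟨X, hX, rfl⟩
    exact h.node_ne X l hl hX

end MetaBlock

namespace WordRAM

variable {m a w : ℕ} {size : Fin a → ℕ}

/-! ### Weakest preconditions -/

/-- The program `p` halts when started in `s`, and running time and final state satisfy `Q`. -/
def WP (w : ℕ) (size : Fin a → ℕ) (p : Cmd m a) (Q : ℕ → State m a → Prop) (s : State m a) : Prop :=
  ∃ t s', Exec w size p s t s' ∧ Q t s'

namespace WP

variable {Q Q' : ℕ → State m a → Prop} {s : State m a} {p q : Cmd m a}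

theorem mono (h : WP w size p Q s) (hQ : ∀ t s', Q t s' → Q' t s') : WP w size p Q' s := by
  obtain ⟨t, s', h1, h2⟩ := h
  exact ⟨t, s', h1, hQ t s' h2⟩

/-- Determinism turns a statement about one execution into a statement about every execution, which
is what induction over `Reach` needs. -/
theorem of_exec (h : WP w size p Q s) {t : ℕ} {s' : State m a} (he : Exec w size p s t s') :
    Q t s' := by
  obtain ⟨t₁, s₁, h1, h2⟩ := h
  obtain ⟨rfl, rfl⟩ := h1.deterministic he
  exact h2

/-- This and the following equivalences are rewriting rules with which `simp` executes straight-line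
code symbolically. -/
theorem skip_iff : WP w size .skip Q s ↔ Q 1 s :=
  ⟨fun h => h.of_exec (.skip s), fun h => ⟨_, _, .skip s, h⟩⟩

theorem const_iff {dst : Fin m} {v : ℕ} :
    WP w size (.const dst v) Q s ↔ Q 1 (s.setReg dst (v % 2 ^ w)) :=
  ⟨fun h => h.of_exec (.const s dst v), fun h => ⟨_, _, .const s dst v, h⟩⟩

theorem copy_iff {dst x : Fin m} :
    WP w size (.copy dst x) Q s ↔ Q 1 (s.setReg dst (s.reg x)) :=
  ⟨fun h => h.of_exec (.copy s dst x), fun h => ⟨_, _, .copy s dst x, h⟩⟩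

theorem op_iff {o : BinOp} {dst x y : Fin m} :
    WP w size (.op o dst x y) Q s ↔ Q 1 (s.setReg dst (o.eval w (s.reg x) (s.reg y))) :=
  ⟨fun h => h.of_exec (.op s o dst x y), fun h => ⟨_, _, .op s o dst x y, h⟩⟩

theorem load_iff {dst : Fin m} {arr : Fin a} {idx : Fin m} :
    WP w size (.load dst arr idx) Q s ↔
      s.reg idx < size arr ∧ Q 1 (s.setReg dst (s.mem arr (s.reg idx))) := by
  constructor
  · rintro ⟨_, _, h, hQ⟩
    cases h
    exact ⟨‹_›, hQ⟩
  · rintro ⟨h, hQ⟩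
    exact ⟨_, _, .load s dst arr idx h, hQ⟩

theorem store_iff {arr : Fin a} {idx x : Fin m} :
    WP w size (.store arr idx x) Q s ↔
      s.reg idx < size arr ∧ Q 1 (s.setMem arr (s.reg idx) (s.reg x)) := by
  constructor
  · rintro ⟨_, _, h, hQ⟩
    cases h
    exact ⟨‹_›, hQ⟩
  · rintro ⟨h, hQ⟩
    exact ⟨_, _, .store s arr idx x h, hQ⟩

theorem seq_iff :
    WP w size (.seq p q) Q s ↔ WP w size p (fun t s' => WP w size q (fun t' => Q (t + t')) s') s := by
  constructor
  · rintro ⟨_, _, h, hQ⟩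
    cases h with
    | seq hp hq => exact ⟨_, _, hp, _, _, hq, hQ⟩
  · rintro ⟨_, _, hp, _, _, hq, hQ⟩
    exact ⟨_, _, .seq hp hq, hQ⟩

theorem ite_iff {x : Fin m} :
    WP w size (.ite x p q) Q s ↔
      WP w size (if s.reg x ≠ 0 then p else q) (fun t => Q (t + 1)) s := by
  constructor
  · rintro ⟨_, _, h, hQ⟩
    cases h with
    | ite_true hx hp => rw [if_pos hx]; exact ⟨_, _, hp, hQ⟩
    | ite_false hx hq => rw [if_neg (not_not.2 hx)]; exact ⟨_, _, hq, hQ⟩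
  · rintro ⟨_, _, h, hQ⟩
    split_ifs at h with hx
    · exact ⟨_, _, .ite_true hx h, hQ⟩
    · exact ⟨_, _, .ite_false (not_not.1 hx) h, hQ⟩

/-- A loop with an invariant `I n` whose index `n` decreases in every round. -/
theorem loop {x : Fin m} (I : ℕ → State m a → Prop) (c : ℕ)
    (hI : ∀ n s, I n s → s.reg x ≠ 0 → WP w size p (fun t s' => t ≤ c ∧ ∃ n' < n, I n' s') s)
    {n : ℕ} (hs : I n s)
    (hQ : ∀ t s' n', I n' s' → s'.reg x = 0 → t ≤ n * (c + 1) + 1 → Q t s') :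
    WP w size (.loop x p) Q s := by
  suffices h : ∀ n s, I n s → WP w size (.loop x p)
      -- Each round costs at most `c` steps plus one test; the final `1` is the test that fails.
      (fun t s' => t ≤ n * (c + 1) + 1 ∧ s'.reg x = 0 ∧ ∃ n', I n' s') s from
    (h n s hs).mono fun t s' ⟨h1, h2, n', h3⟩ => hQ t s' n' h3 h2 h1
  intro n
  induction n using Nat.strong_induction_on with
  | _ n ih =>
    intro s hs
    by_cases hx : s.reg x = 0
    · exact ⟨_, _, .loop_done hx, by omega, hx, n, hs⟩
    · obtain ⟨t₁, s₁, he₁, ht₁, n', hn', hs₁⟩ := hI n s hs hx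
      obtain ⟨t₂, s₂, he₂, ht₂, hx₂, h₂⟩ := ih n' hn' s₁ hs₁
      refine ⟨_, _, .loop_step hx he₁ he₂, ?_, hx₂, h₂⟩
      have : (n' + 1) * (c + 1) ≤ n * (c + 1) := Nat.mul_le_mul_right _ hn'
      rw [add_mul] at this
      omega

end WP

/-! ### Registers and arrays after updates -/

namespace State

variable (s : State m a)

theorem reg_setReg (x y : Fin m) (v : ℕ) :
    (s.setReg x v).reg y = if y = x then v else s.reg y := by
  simp [setReg, Function.update_apply]

theorem mem_setReg (x : Fin m) (v : ℕ) : (s.setReg x v).mem = s.mem := rfl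

theorem setReg_setReg_self (x : Fin m) (v v' : ℕ) : (s.setReg x v).setReg x v' = s.setReg x v' := by
  simp [setReg]

/-- Replacement of a whole array. -/
def setArr (arr : Fin a) (M : ℕ → ℕ) : State m a := { s with mem := Function.update s.mem arr M }

theorem reg_setArr (arr : Fin a) (M : ℕ → ℕ) : (s.setArr arr M).reg = s.reg := rfl

theorem mem_setArr (arr arr' : Fin a) (M : ℕ → ℕ) :
    (s.setArr arr M).mem arr' = if arr' = arr then M else s.mem arr' := by
  simp [setArr, Function.update_apply]

end State

/-- The case `y = 2 ^ w` occurs when `r = 1` and `σ = 2 ^ w`: the register for `σ` then holds `0`,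
and the convention `x / 0 = 0` gives the correct quotient. -/
theorem div_mod_two_pow {x y : ℕ} (hx : x < 2 ^ w) (hy : y ≤ 2 ^ w) : x / (y % 2 ^ w) = x / y := by
  rcases hy.lt_or_eq with h | rfl
  · rw [Nat.mod_eq_of_lt h]
  · rw [Nat.mod_self, Nat.div_zero, Nat.div_eq_of_lt hx]

end WordRAM

namespace MetaBlock

open WordRAM

/-! ### The programs

The arrays hold the leaf table (`0`), the node table (`1`) and the character table (`2`). -/

infixr:60 " ;; " => Cmd.seq

notation "rMax" => (0 : Fin 26)
notation "rLen" => (1 : Fin 26)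
notation "rWord" => (2 : Fin 26)
notation "rChar" => (3 : Fin 26)
notation "rArg" => (4 : Fin 26)
notation "rBlock" => (5 : Fin 26)
notation "rShift" => (6 : Fin 26)
notation "rSig" => (7 : Fin 26)
notation "rBits" => (8 : Fin 26)
notation "rMask" => (9 : Fin 26)
notation "rPer" => (10 : Fin 26)
notation "rTopPow" => (11 : Fin 26)
notation "rTopOff" => (12 : Fin 26)
notation "rCur" => (13 : Fin 26)
notation "rCnt" => (14 : Fin 26)
notation "rOne" => (15 : Fin 26)
notation "rX" => (16 : Fin 26)
notation "rPow" => (17 : Fin 26)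
notation "rOff" => (18 : Fin 26)
notation "rIdx" => (19 : Fin 26)
notation "rVal" => (20 : Fin 26)
notation "rT" => (21 : Fin 26)
notation "rU" => (22 : Fin 26)
notation "rV" => (23 : Fin 26)
notation "rW" => (24 : Fin 26)
notation "rFlag" => (25 : Fin 26)

/-- `rVal := arr[rIdx]` in a packed array. -/
def fetch (arr : Fin 3) : Cmd 26 3 :=
  .op .div rT rIdx rPer ;; .op .mod rU rIdx rPer ;; .op .mul rU rU rBits ;;
  .load rVal arr rT ;; .op .shr rVal rVal rU ;; .op .and rVal rVal rMask

/-- `arr[rIdx] := rVal` in a packed array. -/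
def put (arr : Fin 3) : Cmd 26 3 :=
  .op .div rT rIdx rPer ;; .op .mod rU rIdx rPer ;; .op .mul rU rU rBits ;;
  .load rV arr rT ;; .op .shr rW rV rU ;; .op .and rW rW rMask ;; .op .xor rW rW rVal ;;
  .op .shl rW rW rU ;; .op .xor rV rV rW ;; .store arr rT rV

/-- The mask runs through `2 ^ b - 1` until it is at least `σ - 1`; the first such `b` is `⌈log₂
σ⌉`. -/
def maskStep : Cmd 26 3 :=
  .op .add rMask rMask rMask ;; .op .add rMask rMask rOne ;; .op .add rBits rBits rOne ;;
  .op .lt rFlag rMask rMax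

def powStep : Cmd 26 3 :=
  .op .mul rTopPow rTopPow rSig ;; .op .mul rTopOff rTopOff rSig ;;
  .op .add rTopOff rTopOff rOne ;; .op .sub rFlag rFlag rOne

def setupCmd : Cmd 26 3 :=
  .const rOne 1 ;; .op .add rSig rMax rOne ;; .op .lt rFlag rMask rMax ;;
  .loop rFlag maskStep ;;
  .op .div rPer rWord rBits ;; .copy rTopPow rOne ;; .op .sub rFlag rLen rOne ;;
  .loop rFlag powStep

/-- Enters the suffix of the block `rCur` on one level; `rX` holds the next longer suffix. -/
def insertStep : Cmd 26 3 :=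
  .op .div rVal rX rPow ;; .op .mod rX rX rPow ;; .op .add rIdx rOff rX ;;
  put 2 ;; .copy rVal rOne ;; put 1 ;;
  .op .div rPow rPow rSig ;; .op .div rOff rOff rSig

/-- Enters the block `rCur`. -/
def insertCmd : Cmd 26 3 :=
  .copy rIdx rCur ;; .copy rVal rOne ;; put 0 ;;
  .copy rX rCur ;; .copy rPow rTopPow ;; .copy rOff rTopOff ;;
  .loop rPow insertStep

def appendCmd : Cmd 26 3 :=
  .op .mul rCur rCur rSig ;; .op .add rCur rCur rChar ;; .op .add rCnt rCnt rOne ;;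
  .op .eq rFlag rCnt rLen ;;
  .ite rFlag (insertCmd ;; .const rCur 0 ;; .const rCnt 0) .skip

/-- `rFlag` becomes nonzero if the string `rX` is not in the trie and is not empty. -/
def testNode : Cmd 26 3 :=
  -- Among the levels, only that of the empty string has offset `0`, so the product with `rOff`
  -- stops the search there even if the trie is empty.
  .op .add rIdx rOff rX ;; fetch 1 ;; .op .lt rFlag rVal rOne ;; .op .mul rFlag rFlag rOff

/-- Removes the last character of `rX`. -/
def shortenStep : Cmd 26 3 :=
  .op .div rX rX rSig ;; .op .div rPow rPow rSig ;; .op .div rOff rOff rSig ;;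
  .op .add rShift rShift rOne ;; testNode

/-- Extends `rX` to the left by the stored character. -/
def extendStep : Cmd 26 3 :=
  .op .add rIdx rOff rX ;; fetch 2 ;; .op .mul rVal rVal rPow ;; .op .add rX rX rVal ;;
  .op .mul rOff rOff rSig ;; .op .add rOff rOff rOne ;; .op .mul rPow rPow rSig ;;
  .op .sub rFlag rFlag rOne

/-- Finds the longest prefix of `rArg` that is a suffix of a block. -/
def searchCmd : Cmd 26 3 :=
  .op .div rX rArg rSig ;; .copy rPow rTopPow ;; .copy rOff rTopOff ;; .const rShift 1 ;;
  testNode ;; .loop rFlag shortenStep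

/-- Nodes exist only for lengths below `r`, so `A` itself is looked up in the leaf table before any
shortening. -/
def queryCmd : Cmd 26 3 :=
  .copy rX rArg ;; .copy rIdx rArg ;; fetch 0 ;;
  .ite rVal (.const rShift 0) searchCmd ;;
  .copy rFlag rShift ;; .loop rFlag extendStep ;; .copy rBlock rX

def trieStructure : OnlineStructure 26 3 where
  setup := setupCmd
  append := appendCmd
  query := queryCmd
  maxCharReg := rMax
  lenReg := rLen
  wordReg := rWord
  charReg := rChar
  argReg := rArg
  blockReg := rBlock
  shiftReg := rShift

/-! ### Correctness of the programs -/

/-- The parameters that the structure can handle. -/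
structure Admissible (σ r w : ℕ) : Prop where
  two_le : 2 ≤ σ
  one_le : 1 ≤ r
  pow_le : σ ^ r ≤ 2 ^ w

/-- The number of fields in a word. -/
def perWord (σ w : ℕ) : ℕ := w / Nat.clog 2 σ

/-- The sizes of the arrays. -/
def arraySize (σ r w : ℕ) (_ : Fin 3) : ℕ := σ ^ r / perWord σ w + 1

namespace Admissible

variable {σ r w : ℕ}

theorem base_le (h : Admissible σ r w) : σ ≤ 2 ^ w :=
  (Nat.le_self_pow (by have := h.one_le; omega) σ).trans h.pow_le

theorem base_pos (h : Admissible σ r w) : 0 < σ := by have := h.two_le; omega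

theorem word_pos (h : Admissible σ r w) : 1 ≤ w := by
  have h1 := h.base_le
  have h2 := h.two_le
  rcases Nat.eq_zero_or_pos w with rfl | hw
  · simp at h1; omega
  · exact hw

theorem one_lt (h : Admissible σ r w) : 1 < 2 ^ w :=
  Nat.one_lt_two_pow (by have := h.word_pos; omega)

theorem pow_lt (h : Admissible σ r w) {l : ℕ} (hl : l < r) : σ ^ l < 2 ^ w :=
  (Nat.pow_lt_pow_right h.two_le hl).trans_le h.pow_le

theorem len_lt (h : Admissible σ r w) : r < 2 ^ w :=
  (Nat.lt_pow_self h.two_le).trans_le h.pow_le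

theorem bits_pos (h : Admissible σ r w) : 0 < Nat.clog 2 σ :=
  Nat.clog_pos (by norm_num) h.two_le

theorem bits_le (h : Admissible σ r w) : Nat.clog 2 σ ≤ w :=
  (Nat.clog_le_iff_le_pow (by norm_num)).2 h.base_le

theorem le_two_pow_bits (_ : Admissible σ r w) : σ ≤ 2 ^ Nat.clog 2 σ :=
  Nat.le_pow_clog (by norm_num) σ

theorem perWord_pos (h : Admissible σ r w) : 0 < perWord σ w :=
  Nat.div_pos h.bits_le h.bits_pos

theorem shift_add_le (h : Admissible σ r w) (i : ℕ) :
    i % perWord σ w * Nat.clog 2 σ + Nat.clog 2 σ ≤ w := by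
  have h1 : (i % perWord σ w + 1) * Nat.clog 2 σ ≤ perWord σ w * Nat.clog 2 σ :=
    Nat.mul_le_mul_right _ (Nat.mod_lt _ h.perWord_pos)
  have h2 : perWord σ w * Nat.clog 2 σ ≤ w := Nat.div_mul_le_self _ _
  rw [add_mul, one_mul] at h1
  omega

theorem shift_lt (h : Admissible σ r w) (i : ℕ) :
    i % perWord σ w * Nat.clog 2 σ < 2 ^ w := by
  have h1 := h.shift_add_le i
  have h2 : w < 2 ^ w := Nat.lt_two_pow_self
  omega

theorem div_lt_size (_ : Admissible σ r w) {i : ℕ} (hi : i < σ ^ r) (arr : Fin 3) :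
    i / perWord σ w < arraySize σ r w arr :=
  Nat.lt_succ_of_le (Nat.div_le_div_right hi.le)

end Admissible

/-- The registers that are computed by `setup` and not changed later. -/
structure Params (σ r w : ℕ) (s : State 26 3) : Prop where
  len : s.reg rLen = r
  -- Reduced modulo `2 ^ w`, since `σ = 2 ^ w` is allowed when `r = 1`.
  sig : s.reg rSig = σ % 2 ^ w
  bits : s.reg rBits = Nat.clog 2 σ
  mask : s.reg rMask = 2 ^ Nat.clog 2 σ - 1
  per : s.reg rPer = perWord σ w
  topPow : s.reg rTopPow = σ ^ (r - 1)
  topOff : s.reg rTopOff = levelOffset σ (r - 1)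
  one : s.reg rOne = 1

section

variable {σ r w : ℕ} {s : State 26 3} {Q : ℕ → State 26 3 → Prop}

theorem Params.congr {s' : State 26 3} (h : Params σ r w s)
    (hs : ∀ x : Fin 26, 7 ≤ (x : ℕ) ∧ (x : ℕ) ≤ 12 ∨ x = 1 ∨ x = 15 → s'.reg x = s.reg x) :
    Params σ r w s' where
  len := by rw [hs _ (by decide), h.len]
  sig := by rw [hs _ (by decide), h.sig]
  bits := by rw [hs _ (by decide), h.bits]
  mask := by rw [hs _ (by decide), h.mask]
  per := by rw [hs _ (by decide), h.per]
  topPow := by rw [hs _ (by decide), h.topPow]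
  topOff := by rw [hs _ (by decide), h.topOff]
  one := by rw [hs _ (by decide), h.one]

theorem Params.setReg (h : Params σ r w s) {x : Fin 26} (v : ℕ)
    (hx : ¬ (7 ≤ (x : ℕ) ∧ (x : ℕ) ≤ 12 ∨ x = 1 ∨ x = 15)) : Params σ r w (s.setReg x v) := by
  refine h.congr fun y hy => ?_
  rw [State.reg_setReg, if_neg]
  rintro rfl
  exact hx hy

theorem Params.setArr (h : Params σ r w s) (arr : Fin 3) (M : ℕ → ℕ) :
    Params σ r w (s.setArr arr M) := h.congr fun _ _ => rfl

/-- The scratch registers receive arbitrary values in `hQ`, so callers cannot depend on them. -/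
theorem fetch_wp (hp : Admissible σ r w) (hs : Params σ r w s) {arr : Fin 3}
    (hi : s.reg rIdx < σ ^ r)
    (hQ : ∀ t u, Q 6 (((s.setReg rT t).setReg rU u).setReg rVal
      (field (Nat.clog 2 σ) (perWord σ w) (s.mem arr) (s.reg rIdx)))) :
    WP w (arraySize σ r w) (fetch arr) Q s := by
  have h1 := hp.div_lt_size hi arr
  have h2 := Nat.mod_eq_of_lt (hp.shift_lt (s.reg rIdx))
  simp only [fetch, WP.seq_iff, WP.op_iff, WP.load_iff, BinOp.eval, State.reg_setReg,
    State.mem_setReg, Fin.reduceEq, if_true, if_false, hs.per, hs.bits, hs.mask, h2,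
    State.setReg_setReg_self]
  exact ⟨h1, hQ _ _⟩

theorem put_wp (hp : Admissible σ r w) (hs : Params σ r w s) {arr : Fin 3}
    (hi : s.reg rIdx < σ ^ r) (hc : s.reg rVal < σ)
    (hQ : ∀ t u v x y, Q 10 ((((((s.setReg rT t).setReg rU u).setReg rV v).setReg rW x).setReg rV y)
      |>.setArr arr
        (setField (Nat.clog 2 σ) (perWord σ w) (s.mem arr) (s.reg rIdx) (s.reg rVal)))) :
    WP w (arraySize σ r w) (put arr) Q s := by
  have h1 := hp.div_lt_size hi arr
  have h2 := Nat.mod_eq_of_lt (hp.shift_lt (s.reg rIdx))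
  -- The slot of the field lies inside the word, so the left shift loses no bits.
  have h3 : (field (Nat.clog 2 σ) (perWord σ w) (s.mem arr) (s.reg rIdx) ^^^ s.reg rVal)
      <<< (s.reg rIdx % perWord σ w * Nat.clog 2 σ) < 2 ^ w := by
    rw [Nat.shiftLeft_eq]
    refine (Nat.mul_lt_mul_of_pos_right (Nat.xor_lt_two_pow (field_lt _ _ _ _)
      (hc.trans_le hp.le_two_pow_bits)) (by positivity)).trans_le ?_
    rw [← pow_add]
    exact Nat.pow_le_pow_right (by norm_num) (by have := hp.shift_add_le (s.reg rIdx); omega)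
  have h4 := Nat.mod_eq_of_lt h3
  rw [field] at h4
  simp only [put, WP.seq_iff, WP.op_iff, WP.load_iff, WP.store_iff, BinOp.eval, State.reg_setReg,
    State.mem_setReg, Fin.reduceEq, if_true, if_false, hs.per, hs.bits, hs.mask, h2, h4,
    State.setReg_setReg_self]
  exact ⟨h1, h1, hQ _ _ _ _ _⟩

theorem sub_one_eval {e : ℕ} (h0 : e ≠ 0) (he : e < 2 ^ w) : (e + (2 ^ w - 1)) % 2 ^ w = e - 1 := by
  rw [show e + (2 ^ w - 1) = (e - 1) + 2 ^ w by omega, Nat.add_mod_right]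
  exact Nat.mod_eq_of_lt (by omega)

/-! #### Setup -/

theorem maskLoop_wp (hp : Admissible σ r w) (hmax : s.reg rMax = σ - 1) (hone : s.reg rOne = 1)
    (hmask : s.reg rMask = 0) (hbits : s.reg rBits = 0)
    (hflag : s.reg rFlag = if 0 < σ - 1 then 1 else 0)
    (hQ : ∀ t s', t ≤ Nat.clog 2 σ * 5 + 1 → s'.reg rBits = Nat.clog 2 σ →
      s'.reg rMask = 2 ^ Nat.clog 2 σ - 1 → s'.mem = s.mem →
      (∀ x : Fin 26, x ≠ rBits → x ≠ rMask → x ≠ rFlag → s'.reg x = s.reg x) → Q t s') :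
    WP w (arraySize σ r w) (.loop rFlag maskStep) Q s := by
  have hmod : 1 % 2 ^ w = 1 := Nat.mod_eq_of_lt hp.one_lt
  have hσ := hp.two_le
  -- The index `n` counts the bits still missing from the mask.
  refine WP.loop (fun n s' => n + s'.reg rBits = Nat.clog 2 σ ∧
      s'.reg rMask = 2 ^ s'.reg rBits - 1 ∧
      s'.reg rFlag = (if s'.reg rMask < σ - 1 then 1 else 0) ∧ s'.mem = s.mem ∧
      (∀ x : Fin 26, x ≠ rBits → x ≠ rMask → x ≠ rFlag → s'.reg x = s.reg x)) 4 ?_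
    (n := Nat.clog 2 σ) ⟨by rw [hbits, add_zero], by rw [hbits, hmask]; rfl, by rw [hflag, hmask],
      rfl, fun _ _ _ _ => rfl⟩ ?_
  · rintro n s' ⟨hn, hm, hf, hmem, hfr⟩ hne
    have hlt : s'.reg rMask < σ - 1 := by
      by_contra h
      rw [if_neg h] at hf
      exact hne hf
    have hb : s'.reg rBits < Nat.clog 2 σ := by
      rw [Nat.lt_clog_iff_pow_lt (by norm_num)]
      omega
    have hpow : 2 ^ (s'.reg rBits + 1) ≤ 2 ^ w :=
      Nat.pow_le_pow_right (by norm_num) (hb.trans_le hp.bits_le)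
    have hpos : 0 < 2 ^ s'.reg rBits := by positivity
    have hww : w < 2 ^ w := Nat.lt_two_pow_self
    have hbw := hp.bits_le
    rw [pow_succ] at hpow
    have e1 : (s'.reg rMask + s'.reg rMask) % 2 ^ w = s'.reg rMask + s'.reg rMask :=
      Nat.mod_eq_of_lt (by omega)
    have e2 : (s'.reg rMask + s'.reg rMask + 1) % 2 ^ w = s'.reg rMask + s'.reg rMask + 1 :=
      Nat.mod_eq_of_lt (by omega)
    have e3 : (s'.reg rBits + 1) % 2 ^ w = s'.reg rBits + 1 :=
      Nat.mod_eq_of_lt (by omega)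
    have o1 : s'.reg rOne = 1 := by rw [hfr _ (by decide) (by decide) (by decide), hone]
    have o2 : s'.reg rMax = σ - 1 := by rw [hfr _ (by decide) (by decide) (by decide), hmax]
    simp only [maskStep, WP.seq_iff, WP.op_iff, BinOp.eval, State.reg_setReg, State.mem_setReg,
      Fin.reduceEq, if_true, if_false, o1, o2, e1, e2, e3, hmod]
    refine ⟨by norm_num, n - 1, by omega, by omega, ?_, trivial, hmem, fun x h1 h2 h3 => ?_⟩
    · rw [pow_succ]; omega
    · simp [h1, h2, h3, hfr x h1 h2 h3]
  · rintro t s' n ⟨hn, hm, hf, hmem, hfr⟩ hz ht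
    have hge : ¬ s'.reg rMask < σ - 1 := by
      intro h
      rw [if_pos h, hz] at hf
      omega
    have hb : Nat.clog 2 σ ≤ s'.reg rBits := by
      rw [Nat.clog_le_iff_le_pow (by norm_num)]
      omega
    have hb' : s'.reg rBits = Nat.clog 2 σ := by omega
    exact hQ t s' ht hb' (by rw [hm, hb']) hmem hfr

theorem powLoop_wp (hp : Admissible σ r w) (hone : s.reg rOne = 1) (hsig : s.reg rSig = σ % 2 ^ w)
    (hpow : s.reg rTopPow = 1) (hoff : s.reg rTopOff = 0) (hflag : s.reg rFlag = r - 1)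
    (hQ : ∀ t s', t ≤ (r - 1) * 5 + 1 → s'.reg rTopPow = σ ^ (r - 1) →
      s'.reg rTopOff = levelOffset σ (r - 1) → s'.mem = s.mem →
      (∀ x : Fin 26, x ≠ rTopPow → x ≠ rTopOff → x ≠ rFlag → s'.reg x = s.reg x) → Q t s') :
    WP w (arraySize σ r w) (.loop rFlag powStep) Q s := by
  have hr := hp.one_le
  have hσ := hp.two_le
  refine WP.loop (fun n s' => n ≤ r - 1 ∧ s'.reg rFlag = n ∧ s'.reg rTopPow = σ ^ (r - 1 - n) ∧
      s'.reg rTopOff = levelOffset σ (r - 1 - n) ∧ s'.mem = s.mem ∧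
      (∀ x : Fin 26, x ≠ rTopPow → x ≠ rTopOff → x ≠ rFlag → s'.reg x = s.reg x)) 4 ?_
    (n := r - 1) ⟨le_rfl, hflag, by simp [hpow], by simp [hoff, levelOffset],
      rfl, fun _ _ _ _ => rfl⟩ ?_
  · rintro n s' ⟨hn, hf, hpw, ho, hmem, hfr⟩ hne
    have o1 : s'.reg rOne = 1 := by rw [hfr _ (by decide) (by decide) (by decide), hone]
    have o2 : s'.reg rSig = σ % 2 ^ w := by rw [hfr _ (by decide) (by decide) (by decide), hsig]
    have hlen := hp.len_lt
    rw [hf] at hne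
    have e0 : r - 1 - (n - 1) = r - 1 - n + 1 := by omega
    have e1 : σ ^ (r - 1 - n) * (σ % 2 ^ w) % 2 ^ w = σ ^ (r - 1 - (n - 1)) := by
      rw [Nat.mul_mod_mod, ← pow_succ, ← e0]
      exact Nat.mod_eq_of_lt (hp.pow_lt (by omega))
    have e2 : (levelOffset σ (r - 1 - n) * (σ % 2 ^ w) % 2 ^ w + 1) % 2 ^ w =
        levelOffset σ (r - 1 - (n - 1)) := by
      rw [Nat.mul_mod_mod, Nat.mod_add_mod, ← levelOffset_succ', ← e0]
      exact Nat.mod_eq_of_lt ((levelOffset_lt_pow hσ _).trans (hp.pow_lt (by omega)))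
    have e3 := sub_one_eval (w := w) hne (by omega)
    simp only [powStep, WP.seq_iff, WP.op_iff, BinOp.eval, State.reg_setReg, State.mem_setReg,
      Fin.reduceEq, if_true, if_false, o1, o2, hf, hpw, ho, e1, e2, e3]
    refine ⟨by norm_num, n - 1, by omega, by omega, rfl, rfl, rfl, hmem,
      fun x h1 h2 h3 => ?_⟩
    simp [h1, h2, h3, hfr x h1 h2 h3]
  · rintro t s' n ⟨hn, hf, hpw, ho, hmem, hfr⟩ hz ht
    rw [hz] at hf
    subst hf
    exact hQ t s' ht hpw ho hmem hfr

theorem setup_wp (hp : Admissible σ r w)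
    (hQ : ∀ t s', t ≤ 5 * r + 5 * Nat.clog 2 σ + 8 → Params σ r w s' → s'.reg rCur = 0 →
      s'.reg rCnt = 0 → s'.mem = (fun _ _ => 0) → Q t s') :
    WP w (arraySize σ r w) setupCmd Q (trieStructure.start σ r w) := by
  have hmod : 1 % 2 ^ w = 1 := Nat.mod_eq_of_lt hp.one_lt
  have hr := hp.one_le
  have hσ := hp.two_le
  have hsig : σ - 1 + 1 = σ := by omega
  simp only [setupCmd, WP.seq_iff, WP.op_iff, WP.const_iff, WP.copy_iff, BinOp.eval,
    OnlineStructure.start, trieStructure, State.reg_setReg, State.zero,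
    Fin.reduceEq, if_true, if_false, hmod, hsig]
  refine maskLoop_wp hp ?_ ?_ ?_ ?_ ?_ ?_
  · simp [State.reg_setReg]
  · simp [State.reg_setReg]
  · simp [State.reg_setReg]
  · simp [State.reg_setReg]
  · simp [State.reg_setReg]
  intro t s' ht hb hm hmem hfr
  have f : ∀ x : Fin 26, x ≠ rBits → x ≠ rMask → x ≠ rFlag → _ := hfr
  simp only [State.reg_setReg, State.mem_setReg] at f hmem
  have fLen := f rLen (by decide) (by decide) (by decide)
  have fWord := f rWord (by decide) (by decide) (by decide)
  have fOne := f rOne (by decide) (by decide) (by decide)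
  have fSig := f rSig (by decide) (by decide) (by decide)
  have fOff := f rTopOff (by decide) (by decide) (by decide)
  have fCur := f rCur (by decide) (by decide) (by decide)
  have fCnt := f rCnt (by decide) (by decide) (by decide)
  simp only [Fin.reduceEq, if_true, if_false] at fLen fWord fOne fSig fOff fCur fCnt
  have e := sub_one_eval (w := w) (e := r) (by omega) hp.len_lt
  simp only [fLen, fWord, fOne, hb, e]
  refine powLoop_wp hp ?_ ?_ ?_ ?_ ?_ ?_
  · simp [State.reg_setReg, fOne]
  · simp [State.reg_setReg, fSig]
  · simp [State.reg_setReg]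
  · simp [State.reg_setReg, fOff]
  · simp [State.reg_setReg]
  intro t' s'' ht' hpw ho hmem' hfr'
  simp only [State.reg_setReg, State.mem_setReg] at hfr' hmem'
  have g : ∀ x : Fin 26, x ≠ rTopPow → x ≠ rTopOff → x ≠ rFlag → x ≠ rPer →
      s''.reg x = s'.reg x := by
    intro x h1 h2 h3 h4
    rw [hfr' x h1 h2 h3]
    simp [h1, h3, h4]
  refine hQ _ _ (by omega) ⟨?_, ?_, ?_, ?_, ?_, hpw, ho, ?_⟩ ?_ ?_ (by rw [hmem', hmem])
  · rw [g _ (by decide) (by decide) (by decide) (by decide), fLen]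
  · rw [g _ (by decide) (by decide) (by decide) (by decide), fSig]
  · rw [g _ (by decide) (by decide) (by decide) (by decide), hb]
  · rw [g _ (by decide) (by decide) (by decide) (by decide), hm]
  · rw [hfr' _ (by decide) (by decide) (by decide)]
    simp [perWord]
  · rw [g _ (by decide) (by decide) (by decide) (by decide), fOne]
  · rw [g _ (by decide) (by decide) (by decide) (by decide), fCur]
  · rw [g _ (by decide) (by decide) (by decide) (by decide), fCnt]

/-! #### Insertion of a block -/

/-- The arrays store the trie of the blocks in `B`. -/
def Stores (σ r w : ℕ) (mem : Fin 3 → ℕ → ℕ) (B : Set ℕ) (D : ℕ → ℕ → Prop) : Prop :=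
  IsTrie σ r (field (Nat.clog 2 σ) (perWord σ w) (mem 0))
    (field (Nat.clog 2 σ) (perWord σ w) (mem 1)) (field (Nat.clog 2 σ) (perWord σ w) (mem 2)) B D

/-- Going down from level `r - 1` to level `0`, the register holds `X % σ ^ n`; one division by `σ ^
(n - 1)` splits it into the preceding character and the next shorter suffix. With index `n`, the
levels from `n` upwards are done. -/
theorem insertLoop_wp (hp : Admissible σ r w) {X : ℕ} {B : Set ℕ} (hX : X < σ ^ r)
    (hs : Params σ r w s) (hx : s.reg rX = X) (hpow : s.reg rPow = σ ^ (r - 1))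
    (hoff : s.reg rOff = levelOffset σ (r - 1))
    (hB : Stores σ r w s.mem (insert X B) fun Y _ => Y ∈ B)
    (hQ : ∀ t s', t ≤ r * 27 + 1 → Params σ r w s' →
      Stores σ r w s'.mem (insert X B) (fun Y _ => Y ∈ insert X B) → Q t s') :
    WP w (arraySize σ r w) (.loop rPow insertStep) Q s := by
  have hr := hp.one_le
  have hσ := hp.two_le
  refine WP.loop (fun n s' => n ≤ r ∧ Params σ r w s' ∧
      -- After the root, `1 / σ = 0` makes the power vanish and ends the loop.
      s'.reg rPow = (if n = 0 then 0 else σ ^ (n - 1)) ∧ s'.reg rOff = levelOffset σ (n - 1) ∧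
      s'.reg rX = X % σ ^ n ∧ Stores σ r w s'.mem (insert X B)
        fun Y l => Y ∈ B ∨ Y = X ∧ n ≤ l) 26 ?_ (n := r) ⟨le_rfl, hs, ?_, hoff, ?_, ?_⟩ ?_
  · rintro n s' ⟨hn, hs', hpw, ho, hx', hB'⟩ hne
    obtain ⟨l, rfl⟩ : ∃ l, n = l + 1 := by
      refine ⟨n - 1, ?_⟩
      rcases n with _ | n
      · exact absurd hpw hne
      · rfl
    rw [if_neg (by omega), Nat.add_sub_cancel] at hpw
    rw [Nat.add_sub_cancel] at ho
    have e1 : X % σ ^ (l + 1) / σ ^ l = X / σ ^ l % σ := by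
      rw [pow_succ, Nat.mod_mul_right_div_self]
    have e2 : X % σ ^ (l + 1) % σ ^ l = X % σ ^ l :=
      Nat.mod_mod_of_dvd _ (pow_dvd_pow _ (by omega))
    have hidx : levelOffset σ l + X % σ ^ l < σ ^ r :=
      levelOffset_add_lt hσ hn (Nat.mod_lt _ (by have := hp.base_pos; positivity))
    have e3 : (levelOffset σ l + X % σ ^ l) % 2 ^ w = levelOffset σ l + X % σ ^ l :=
      Nat.mod_eq_of_lt (hidx.trans_le hp.pow_le)
    have e4 : σ ^ l / (σ % 2 ^ w) = if l = 0 then 0 else σ ^ (l - 1) := by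
      rw [div_mod_two_pow (hp.pow_lt hn) hp.base_le]
      rcases l with _ | l
      · exact Nat.div_eq_of_lt (by rw [pow_zero]; omega)
      · rw [pow_succ, Nat.mul_div_cancel _ hp.base_pos]; simp
    have e5 : levelOffset σ l / (σ % 2 ^ w) = levelOffset σ (l - 1) := by
      rw [div_mod_two_pow ((levelOffset_lt_pow hσ l).trans (hp.pow_lt hn)) hp.base_le]
      rcases l with _ | l
      · simp [levelOffset]
      · rw [levelOffset_div hσ]; simp
    simp only [insertStep, WP.seq_iff, WP.op_iff, WP.copy_iff, BinOp.eval, State.reg_setReg,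
      Fin.reduceEq, if_true, if_false, hpw, ho, hx', e1, e2, e3]
    refine put_wp hp ?_ ?_ ?_ ?_
    · exact ((hs'.setReg _ (by decide)).setReg _ (by decide)).setReg _ (by decide)
    · simpa [State.reg_setReg] using hidx
    · simpa [State.reg_setReg] using Nat.mod_lt _ hp.base_pos
    intro t u v x y
    refine put_wp hp ?_ ?_ ?_ ?_
    · refine Params.setReg (Params.setArr ?_ _ _) _ (by decide)
      repeat refine Params.setReg ?_ _ (by decide)
      exact hs'
    · simpa [State.reg_setReg, State.reg_setArr] using hidx
    · simp only [State.reg_setReg, State.reg_setArr, Fin.reduceEq, if_true, if_false, hs'.one]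
      omega
    intro t' u' v' x' y'
    simp only [State.reg_setReg, State.reg_setArr, State.mem_setReg, State.mem_setArr,
      Fin.reduceEq, if_true, if_false, hpw, ho, hs'.one, hs'.sig, e4, e5]
    refine ⟨by norm_num, l, by omega, by omega, ?_, rfl, rfl, rfl, ?_⟩
    · refine hs'.congr fun z hz => ?_
      have hz' : z ≠ 16 ∧ z ≠ 17 ∧ z ≠ 18 ∧ z ≠ 19 ∧ z ≠ 20 ∧ z ≠ 21 ∧ z ≠ 22 ∧ z ≠ 23 ∧ z ≠ 24 := by
        revert z
        decide
      obtain ⟨z1, z2, z3, z4, z5, z6, z7, z8, z9⟩ := hz'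
      simp [State.reg_setReg, State.reg_setArr, z1, z2, z3, z4, z5, z6, z7, z8, z9]
    · have h1 := (IsTrie.insert_node hB' hp.base_pos (n := l) (Set.mem_insert X B)).mono
        (D' := fun Y l' => Y ∈ B ∨ Y = X ∧ l ≤ l') (by
          rintro Y l' - (h | ⟨h, h'⟩)
          · exact Or.inl (Or.inl h)
          · rcases h'.eq_or_lt with rfl | hlt
            · exact Or.inr ⟨h, rfl⟩
            · exact Or.inl (Or.inr ⟨h, hlt⟩))
      simp only [Stores, State.mem_setReg, State.mem_setArr, Fin.reduceEq, if_true, if_false]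
      convert h1 using 1
      · funext j
        rw [field_setField _ _ _ (hp.two_le.trans hp.le_two_pow_bits)]
      · funext j
        rw [field_setField _ _ _ ((Nat.mod_lt _ hp.base_pos).trans_le hp.le_two_pow_bits)]
  · rw [hpow, if_neg (by omega)]
  · rw [hx, Nat.mod_eq_of_lt hX]
  · refine IsTrie.mono hB ?_
    rintro Y l hl (h | ⟨-, h⟩)
    · exact h
    · omega
  · rintro t s' n ⟨hn, hs', hpw, ho, hx', hB'⟩ hz ht
    rcases n with _ | n
    · refine hQ t s' ht hs' (IsTrie.mono hB' ?_)
      rintro Y l - (h | h)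
      · exact Or.inr ⟨h, by omega⟩
      · exact Or.inl h
    · rw [hz, if_neg (by omega)] at hpw
      have : 0 < σ ^ (n + 1 - 1) := by have := hp.base_pos; positivity
      omega

theorem insert_wp (hp : Admissible σ r w) {B : Set ℕ} (hX : s.reg rCur < σ ^ r)
    (hs : Params σ r w s) (hB : Stores σ r w s.mem B fun Y _ => Y ∈ B)
    (hQ : ∀ t s', t ≤ r * 27 + 16 → Params σ r w s' →
      Stores σ r w s'.mem (insert (s.reg rCur) B) (fun Y _ => Y ∈ insert (s.reg rCur) B) → Q t s') :
    WP w (arraySize σ r w) insertCmd Q s := by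
  simp only [insertCmd, WP.seq_iff, WP.copy_iff, State.reg_setReg, Fin.reduceEq, if_false, hs.one]
  refine put_wp hp ((hs.setReg _ (by decide)).setReg _ (by decide)) ?_ ?_ ?_
  · simpa [State.reg_setReg] using hX
  · simpa [State.reg_setReg] using Nat.lt_of_succ_le hp.two_le
  intro t u v x y
  simp only [State.reg_setReg, State.reg_setArr, State.mem_setReg,
    Fin.reduceEq, if_true, if_false, hs.topPow, hs.topOff]
  refine insertLoop_wp (B := B) hp hX ?_ ?_ ?_ ?_ ?_ ?_
  · repeat refine Params.setReg ?_ _ (by decide)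
    refine Params.setArr ?_ _ _
    repeat refine Params.setReg ?_ _ (by decide)
    exact hs
  · simp [State.reg_setReg]
  · simp [State.reg_setReg]
  · simp [State.reg_setReg]
  · have h1 := IsTrie.insert_leaf hB (s.reg rCur)
    simp only [Stores, State.mem_setReg, State.mem_setArr, Fin.reduceEq, if_true, if_false]
    convert h1 using 1
    funext j
    rw [field_setField _ _ _ (hp.two_le.trans hp.le_two_pow_bits)]
  · intro t' s' ht hs' hB'
    exact hQ _ _ (by omega) hs' hB'

/-! #### The invariant and the arrival of a character -/

variable {N : ℕ}

/-- The state after `k` characters of `S`. -/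
structure Invariant (σ r w : ℕ) (S : Fin N → Fin σ) (k : ℕ) (s : State 26 3) : Prop where
  params : Params σ r w s
  cur : s.reg rCur = prefixCode σ (fun i => charSeq S (k / r * r + i)) (k % r)
  cnt : s.reg rCnt = k % r
  trie : Stores σ r w s.mem (blockCodes r S k) fun X _ => X ∈ blockCodes r S k

theorem setup_invariant (hp : Admissible σ r w) (S : Fin N → Fin σ) :
    WP w (arraySize σ r w) setupCmd
      (fun t s => t ≤ 5 * r + 5 * Nat.clog 2 σ + 8 ∧ Invariant σ r w S 0 s)
      (trieStructure.start σ r w) := by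
  refine setup_wp hp fun t s' ht hs hcur hcnt hmem => ⟨ht, hs, ?_, ?_, ?_⟩
  · simp [hcur, prefixCode]
  · simp [hcnt]
  · rw [blockCodes_of_lt S hp.one_le, Stores, hmem]
    refine ⟨?_, ?_, ?_, ?_⟩
    · intro X _; simp [field_zero]
    · intro i; rw [field_zero]; exact hp.base_pos
    · intro X l _ h; exact absurd h (Set.notMem_empty X)
    · intro l x _ _ h; exact absurd (field_zero _ _ _) h

theorem append_invariant (hp : Admissible σ r w) {S : Fin N → Fin σ} {k : ℕ} (hk : k < N)
    (h : Invariant σ r w S k s) :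
    WP w (arraySize σ r w) appendCmd
      (fun t s' => t ≤ 27 * r + 23 ∧ Invariant σ r w S (k + 1) s')
      (s.setReg rChar (S ⟨k, hk⟩ : ℕ)) := by
  have hmod : 1 % 2 ^ w = 1 := Nat.mod_eq_of_lt hp.one_lt
  have hr := hp.one_le
  have hkr := Nat.mod_lt k hr
  have hdm := Nat.div_add_mod' k r
  have hlen := hp.len_lt
  have hs := h.params
  have hchar : (S ⟨k, hk⟩ : ℕ) = charSeq S (k / r * r + k % r) := by
    simp [hdm, charSeq, hk]
  have hlt : prefixCode σ (fun i => charSeq S (k / r * r + i)) (k % r + 1) < σ ^ (k % r + 1) :=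
    prefixCode_lt _ fun i hi => charSeq_lt S (by omega)
  have e1 : (prefixCode σ (fun i => charSeq S (k / r * r + i)) (k % r) * (σ % 2 ^ w) % 2 ^ w +
      (S ⟨k, hk⟩ : ℕ)) % 2 ^ w = prefixCode σ (fun i => charSeq S (k / r * r + i)) (k % r + 1) := by
    rw [Nat.mul_mod_mod, Nat.mod_add_mod, hchar]
    exact Nat.mod_eq_of_lt (hlt.trans_le ((Nat.pow_le_pow_right hp.base_pos hkr).trans hp.pow_le))
  have e2 : (k % r + 1) % 2 ^ w = k % r + 1 := Nat.mod_eq_of_lt (by omega)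
  simp only [appendCmd, WP.seq_iff, WP.op_iff, BinOp.eval, State.reg_setReg,
    Fin.reduceEq, if_true, if_false, hs.one, hs.sig, hs.len, h.cur, h.cnt, e1, e2, hmod,
    WP.ite_iff]
  -- Only a character that completes a meta-block changes the trie.
  by_cases heq : k % r + 1 = r
  · rw [if_pos (by simp [heq])]
    simp only [WP.seq_iff, WP.const_iff]
    refine insert_wp (B := blockCodes r S k) hp ?_ ?_ h.trie ?_
    · simp only [State.reg_setReg, Fin.reduceEq, if_true, if_false]
      rwa [heq] at hlt ⊢
    · repeat refine Params.setReg ?_ _ (by decide)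
      exact hs
    · intro t s' ht hs' hB
      simp only [State.reg_setReg, Fin.reduceEq, if_true, if_false, heq] at hB
      have hk0 : (k + 1) % r = 0 := by
        rw [← hdm, add_assoc, heq, Nat.mul_add_mod', Nat.mod_self]
      refine ⟨by omega, (hs'.setReg _ (by decide)).setReg _ (by decide), ?_, ?_, ?_⟩
      · simp [State.reg_setReg, hk0, prefixCode]
      · simp [State.reg_setReg, hk0]
      · rw [blockCodes_succ_of_eq S hk heq]
        exact hB
  · rw [if_neg (by simp [heq])]
    have hk1 : (k + 1) % r = k % r + 1 := by
      rw [Nat.add_mod, Nat.mod_eq_of_lt (a := 1) (by omega), Nat.mod_eq_of_lt (by omega)]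
    have hk2 : (k + 1) / r = k / r := by
      have := Nat.div_add_mod' (k + 1) r
      apply Nat.eq_of_mul_eq_mul_right hr
      omega
    rw [WP.skip_iff]
    refine ⟨by omega, ?_, ?_, ?_, ?_⟩
    · repeat refine Params.setReg ?_ _ (by decide)
      exact hs
    · simp [State.reg_setReg, hk1, hk2]
    · simp [State.reg_setReg, hk1]
    · rw [blockCodes_succ_of_lt S hk (by omega)]
      exact h.trie

/-! #### Queries -/

/-- The arrays and the registers that persist between calls are the same in `s` and `s'`. -/
structure Keeps (s s' : State 26 3) : Prop where
  mem : s'.mem = s.mem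
  reg : ∀ y : Fin 26, 7 ≤ (y : ℕ) ∧ (y : ℕ) ≤ 15 ∨ y = 1 → s'.reg y = s.reg y

theorem Keeps.refl (s : State 26 3) : Keeps s s := ⟨rfl, fun _ _ => rfl⟩

theorem Keeps.trans {s₁ s₂ s₃ : State 26 3} (h : Keeps s₁ s₂) (h' : Keeps s₂ s₃) : Keeps s₁ s₃ :=
  ⟨h'.mem.trans h.mem, fun y hy => (h'.reg y hy).trans (h.reg y hy)⟩

theorem Keeps.setReg {s s' : State 26 3} (h : Keeps s s') {x : Fin 26} (v : ℕ)
    (hx : ¬ (7 ≤ (x : ℕ) ∧ (x : ℕ) ≤ 15 ∨ x = 1)) : Keeps s (s'.setReg x v) := by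
  refine ⟨h.mem, fun y hy => ?_⟩
  rw [State.reg_setReg, if_neg, h.reg y hy]
  rintro rfl
  exact hx hy

theorem Keeps.params {s s' : State 26 3} (h : Keeps s s') (hs : Params σ r w s) :
    Params σ r w s' := by
  refine hs.congr fun y hy => h.reg y ?_
  revert y
  decide

/-- The entry of a packed table. -/
def entry (σ w : ℕ) (s : State 26 3) (arr : Fin 3) (i : ℕ) : ℕ :=
  field (Nat.clog 2 σ) (perWord σ w) (s.mem arr) i

theorem Keeps.entry_eq {s s' : State 26 3} (h : Keeps s s') (arr : Fin 3) (i : ℕ) :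
    entry σ w s' arr i = entry σ w s arr i := by
  rw [entry, entry, h.mem]

theorem testNode_wp (hp : Admissible σ r w) (hs : Params σ r w s) {l : ℕ} (hl : l < r)
    (hoff : s.reg rOff = levelOffset σ l) (hx : s.reg rX < σ ^ l)
    (hQ : ∀ s', Keeps s s' → s'.reg rX = s.reg rX → s'.reg rPow = s.reg rPow →
      s'.reg rOff = s.reg rOff → s'.reg rShift = s.reg rShift →
      s'.reg rFlag =
        (if entry σ w s 1 (levelOffset σ l + s.reg rX) = 0 then levelOffset σ l else 0) → Q 9 s') :
    WP w (arraySize σ r w) testNode Q s := by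
  have hmod : 1 % 2 ^ w = 1 := Nat.mod_eq_of_lt hp.one_lt
  have hidx := levelOffset_add_lt hp.two_le hl hx
  have e1 := Nat.mod_eq_of_lt (hidx.trans_le hp.pow_le)
  simp only [testNode, WP.seq_iff, WP.op_iff, BinOp.eval, hoff, e1]
  refine fetch_wp hp (hs.setReg _ (by decide)) (by simpa [State.reg_setReg] using hidx) ?_
  intro t u
  refine hQ _ ?_ ?_ ?_ ?_ ?_ ?_
  · repeat refine Keeps.setReg ?_ _ (by decide)
    exact Keeps.refl s
  · simp [State.reg_setReg]
  · simp [State.reg_setReg]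
  · simp [State.reg_setReg]
  · simp [State.reg_setReg]
  · have e2 : levelOffset σ l % 2 ^ w = levelOffset σ l :=
      Nat.mod_eq_of_lt ((levelOffset_lt_pow hp.two_le l).trans (hp.pow_lt hl))
    simp only [State.reg_setReg, State.mem_setReg, Fin.reduceEq, if_true, if_false, hs.one, hmod,
      hoff, Nat.lt_one_iff, entry]
    by_cases h : field (Nat.clog 2 σ) (perWord σ w) (s.mem 1) (levelOffset σ l + s.reg rX) = 0
    · simp [h, e2]
    · simp [h]

/-- After the search: `rX` is the prefix of length `l` of the string with code `A`, and no longer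
prefix is a suffix of a block in `B`. -/
structure Found (σ r : ℕ) (B : Set ℕ) (A l : ℕ) (s : State 26 3) : Prop where
  le : l ≤ r
  shift : s.reg rShift = r - l
  x : s.reg rX = A / σ ^ (r - l)
  -- If `A` is itself a block, these registers are never set, and no extension takes place.
  pow : l < r → s.reg rPow = σ ^ l
  off : l < r → s.reg rOff = levelOffset σ l
  maximal : ∀ X ∈ B, ∀ d < r - l, X % σ ^ (r - d) ≠ A / σ ^ d

theorem div_pow_lt {A l : ℕ} (hA : A < σ ^ r) (hl : l ≤ r) : A / σ ^ (r - l) < σ ^ l := by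
  apply Nat.div_lt_of_lt_mul
  rwa [← pow_add, Nat.sub_add_cancel hl]

theorem Found.x_lt {B : Set ℕ} {A l : ℕ} (h : Found σ r B A l s) (hA : A < σ ^ r) :
    s.reg rX < σ ^ l := by
  rw [h.x]
  exact div_pow_lt hA h.le

/-- A failed test at length `l` says that no block has this prefix of `A` as a suffix, by
`IsTrie.node_ne_iff`; length `r` is excluded by `A ∉ B`. Hence the first success is maximal. The
loop index is the current length. -/
theorem search_wp (hp : Admissible σ r w) (hs : Params σ r w s) {A : ℕ} {B : Set ℕ}
    (hA : A < σ ^ r) (harg : s.reg rArg = A) (hAB : A ∉ B) (hBlt : ∀ X ∈ B, X < σ ^ r)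
    (hB : Stores σ r w s.mem B fun X _ => X ∈ B)
    (hQ : ∀ t s' l, t ≤ 14 * r + 14 → Keeps s s' → Found σ r B A l s' →
      (B.Nonempty → ∃ X ∈ B, X % σ ^ l = s'.reg rX) → Q t s') :
    WP w (arraySize σ r w) searchCmd Q s := by
  have hr := hp.one_le
  have hσ := hp.two_le
  have hmod : 1 % 2 ^ w = 1 := Nat.mod_eq_of_lt hp.one_lt
  have hAw : A < 2 ^ w := hA.trans_le hp.pow_le
  have e0 : A / (σ % 2 ^ w) = A / σ := div_mod_two_pow hAw hp.base_le
  simp only [searchCmd, WP.seq_iff, WP.op_iff, WP.copy_iff, WP.const_iff, BinOp.eval,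
    State.reg_setReg, Fin.reduceEq, if_false, hs.sig, hs.topPow, hs.topOff, harg, hmod, e0]
  have hx1 : A / σ < σ ^ (r - 1) := by
    have := div_pow_lt (l := r - 1) hA (by omega)
    rwa [show r - (r - 1) = 1 by omega, pow_one] at this
  refine testNode_wp (l := r - 1) hp ?_ (by omega) ?_ ?_ ?_
  · repeat refine Params.setReg ?_ _ (by decide)
    exact hs
  · simp [State.reg_setReg]
  · simpa [State.reg_setReg] using hx1
  intro s₁ hk₁ h1 h2 h3 h4 h5
  simp only [State.reg_setReg, Fin.reduceEq, if_true, if_false] at h1 h2 h3 h4 h5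
  have hk₁' : Keeps s s₁ := by
    refine Keeps.trans ?_ hk₁
    repeat refine Keeps.setReg ?_ _ (by decide)
    exact Keeps.refl s
  refine WP.loop (fun l s' => l < r ∧ Keeps s s' ∧ Found σ r B A l s' ∧
    s'.reg rFlag = if entry σ w s 1 (levelOffset σ l + s'.reg rX) = 0 then levelOffset σ l else 0)
    13 ?_ (n := r - 1) ⟨by omega, hk₁',
      ⟨by omega, by rw [h4]; omega, ?_, fun _ => h2, fun _ => h3, ?_⟩, by rw [h5, h1]; rfl⟩ ?_
  · rintro n s' ⟨hn, hk, hF, hflag⟩ hne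
    obtain ⟨l, rfl⟩ : ∃ l, n = l + 1 := by
      refine ⟨n - 1, ?_⟩
      rcases n with _ | n
      · rw [hflag] at hne
        simp [levelOffset] at hne
      · rfl
    have habs : entry σ w s 1 (levelOffset σ (l + 1) + s'.reg rX) = 0 := by
      by_contra h
      rw [if_neg h] at hflag
      exact hne hflag
    have hs' := hk.params hs
    have hlen := hp.len_lt
    have hle : σ ^ (l + 1) < 2 ^ w := hp.pow_lt hn
    have e1 : s'.reg rX / (σ % 2 ^ w) = A / σ ^ (r - l) := by
      rw [div_mod_two_pow ((hF.x_lt hA).trans hle) hp.base_le, hF.x, Nat.div_div_eq_div_mul,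
        ← pow_succ, show r - (l + 1) + 1 = r - l by omega]
    have e2 : s'.reg rPow / (σ % 2 ^ w) = σ ^ l := by
      rw [hF.pow hn, div_mod_two_pow hle hp.base_le, pow_succ, Nat.mul_div_cancel _ hp.base_pos]
    have e3 : s'.reg rOff / (σ % 2 ^ w) = levelOffset σ l := by
      rw [hF.off hn, div_mod_two_pow ((levelOffset_lt_pow hσ _).trans hle) hp.base_le,
        levelOffset_div hσ]
    have e4 : (s'.reg rShift + 1) % 2 ^ w = r - l := by
      rw [hF.shift, show r - (l + 1) + 1 = r - l by omega]
      exact Nat.mod_eq_of_lt (by omega)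
    simp only [shortenStep, WP.seq_iff, WP.op_iff, BinOp.eval, State.reg_setReg, Fin.reduceEq,
      if_false, hs'.sig, hs'.one, e1, e2, e3, e4]
    refine testNode_wp (l := l) hp ?_ (by omega) ?_ ?_ ?_
    · repeat refine Params.setReg ?_ _ (by decide)
      exact hs'
    · simp [State.reg_setReg]
    · simpa [State.reg_setReg] using div_pow_lt hA (by omega)
    intro s₂ hk₂ g1 g2 g3 g4 g5
    simp only [State.reg_setReg, Fin.reduceEq, if_true, if_false] at g1 g2 g3 g4 g5
    have hk' := (((hk.setReg (x := rX) (A / σ ^ (r - l)) (by decide)).setReg (x := rPow) (σ ^ l)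
      (by decide)).setReg (x := rOff) (levelOffset σ l) (by decide)).setReg (x := rShift) (r - l)
      (by decide)
    refine ⟨by norm_num, l, by omega, by omega, hk'.trans hk₂,
      ⟨by omega, g4, g1, fun _ => g2, fun _ => g3, ?_⟩, by rw [g5, g1, hk'.entry_eq]⟩
    · intro X hX d hd
      rcases Nat.lt_or_ge d (r - (l + 1)) with hlt | hge
      · exact hF.maximal X hX d hlt
      · intro heq
        rw [show d = r - (l + 1) by omega, show r - (r - (l + 1)) = l + 1 by omega, ← hF.x] at heq
        exact (IsTrie.node_ne_iff hB hn (hF.x_lt hA)).2 ⟨X, hX, heq⟩ habs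
  · rw [h1, show r - (r - 1) = 1 by omega, pow_one]
  · intro X hX d hd
    rw [show d = 0 by omega, Nat.sub_zero, pow_zero, Nat.div_one, Nat.mod_eq_of_lt (hBlt X hX)]
    rintro rfl
    exact hAB hX
  · rintro t s' l ⟨hl, hk, hF, hflag⟩ hz ht
    refine hQ _ s' l ?_ hk hF ?_
    · have : (r - 1) * (13 + 1) + 14 = 14 * r := by omega
      omega
    rintro ⟨Y, hY⟩
    -- The loop ended either at a stored node or at the empty string, which is a suffix of any
    -- block.
    by_cases habs : entry σ w s 1 (levelOffset σ l + s'.reg rX) = 0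
    · rw [if_pos habs, hz] at hflag
      have hl0 : l = 0 := by
        rcases l with _ | l
        · rfl
        · rw [levelOffset_succ'] at hflag
          omega
      subst hl0
      have := hF.x_lt hA
      rw [pow_zero] at this ⊢
      exact ⟨Y, hY, by omega⟩
    · exact (IsTrie.node_ne_iff hB hl (hF.x_lt hA)).1 habs

/-- By `IsTrie.step` every extension remains a suffix of some block. The digits added lie at
positions `≥ l`, so the matched suffix of length `l` is preserved. The index counts the missing
characters. -/
theorem extendLoop_wp (hp : Admissible σ r w) (hs : Params σ r w s) {A l : ℕ} {B : Set ℕ}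
    (hA : A < σ ^ r) (hB : Stores σ r w s.mem B fun X _ => X ∈ B) (hBlt : ∀ X ∈ B, X < σ ^ r)
    (hF : Found σ r B A l s) (hX : B.Nonempty → ∃ X ∈ B, X % σ ^ l = s.reg rX)
    (hflag : s.reg rFlag = r - l)
    (hQ : ∀ t s', t ≤ 14 * r + 1 → Keeps s s' → s'.reg rShift = s.reg rShift →
      (B.Nonempty → s'.reg rX ∈ B) → s'.reg rX % σ ^ l = A / σ ^ (r - l) → Q t s') :
    WP w (arraySize σ r w) (.loop rFlag extendStep) Q s := by
  have hσ := hp.two_le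
  have hlr := hF.le
  have hxl := hF.x_lt hA
  refine WP.loop (fun n s' => n ≤ r - l ∧ s'.reg rFlag = n ∧ Keeps s s' ∧
      s'.reg rShift = s.reg rShift ∧ s'.reg rX < σ ^ (r - n) ∧
      -- At full length `σ ^ r` may equal `2 ^ w` and wrap to `0`; the values are no longer needed
      -- then.
      (n ≠ 0 → s'.reg rPow = σ ^ (r - n) ∧ s'.reg rOff = levelOffset σ (r - n)) ∧
      (B.Nonempty → ∃ X ∈ B, X % σ ^ (r - n) = s'.reg rX) ∧
      s'.reg rX % σ ^ l = A / σ ^ (r - l)) 13 ?_ (n := r - l)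
    ⟨le_rfl, hflag, Keeps.refl s, rfl, ?_, ?_, ?_, ?_⟩ ?_
  · rintro n s' ⟨hn, hf, hk, hsh, hx, hpo, hBX, hxA⟩ hne
    rw [hf] at hne
    obtain ⟨hpw, ho⟩ := hpo hne
    have hs' := hk.params hs
    have hlen := hp.len_lt
    set m := r - n with hm
    have hmr : m < r := by omega
    have e0 : r - (n - 1) = m + 1 := by omega
    have hidx := levelOffset_add_lt hσ hmr hx
    have e1 := Nat.mod_eq_of_lt (hidx.trans_le hp.pow_le)
    simp only [extendStep, WP.seq_iff, WP.op_iff, BinOp.eval, ho, e1]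
    refine fetch_wp hp (hs'.setReg _ (by decide)) (by simpa [State.reg_setReg] using hidx) ?_
    intro t u
    simp only [State.reg_setReg, State.mem_setReg, Fin.reduceEq, if_true, if_false]
    set c := field (Nat.clog 2 σ) (perWord σ w) (s'.mem 2) (levelOffset σ m + s'.reg rX) with hc
    -- This holds at every address, stored or not, so the word cannot overflow even when `B` is
    -- empty.
    have hcσ : c < σ := by
      rw [hc, hk.mem]
      exact IsTrie.char_lt hB _
    have hxlt : s'.reg rX + c * σ ^ m < σ ^ (m + 1) := by
      rw [pow_succ]
      nlinarith
    have hle : σ ^ (m + 1) ≤ 2 ^ w := (Nat.pow_le_pow_right hp.base_pos hmr).trans hp.pow_le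
    have e2 : (s'.reg rX + c * σ ^ m % 2 ^ w) % 2 ^ w = s'.reg rX + c * σ ^ m := by
      rw [Nat.add_mod_mod]
      exact Nat.mod_eq_of_lt (hxlt.trans_le hle)
    have e3 := sub_one_eval (w := w) hne (by omega)
    simp only [hpw, ho, hf, hs'.sig, hs'.one, e2, e3]
    refine ⟨by norm_num, n - 1, by omega, by omega, rfl, ?_, hsh, by rwa [e0], ?_, ?_, ?_⟩
    · repeat refine Keeps.setReg ?_ _ (by decide)
      exact hk
    · intro hn1
      have hlt : σ ^ (m + 1) < 2 ^ w := hp.pow_lt (by omega)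
      rw [e0, Nat.mul_mod_mod, Nat.mul_mod_mod, Nat.mod_add_mod, ← levelOffset_succ', ← pow_succ]
      exact ⟨Nat.mod_eq_of_lt hlt, Nat.mod_eq_of_lt ((levelOffset_lt_pow hσ _).trans hlt)⟩
    · intro hne'
      obtain ⟨X, hXB, h1⟩ := IsTrie.step hB hmr hx (hBX hne')
      refine ⟨X, hXB, ?_⟩
      rw [e0, h1, hc, hk.mem]
    · rw [← hxA]
      obtain ⟨j, hj⟩ := Nat.exists_eq_add_of_le (show l ≤ m by omega)
      rw [hj, pow_add, mul_left_comm, Nat.add_mul_mod_self_left]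
  · rwa [show r - (r - l) = l by omega]
  · intro hne
    rw [show r - (r - l) = l by omega]
    exact ⟨hF.pow (by omega), hF.off (by omega)⟩
  · rwa [show r - (r - l) = l by omega]
  · rw [Nat.mod_eq_of_lt hxl, hF.x]
  · rintro t s' n ⟨hn, hf, hk, hsh, hx, hpo, hBX, hxA⟩ hz ht
    rw [hz] at hf
    subst hf
    refine hQ t s' ?_ hk hsh ?_ hxA
    · have : (r - l) * (13 + 1) ≤ r * (13 + 1) := Nat.mul_le_mul_right _ (by omega)
      omega
    · intro hne
      obtain ⟨X, hXB, h1⟩ := hBX hne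
      rw [Nat.sub_zero, Nat.mod_eq_of_lt (hBlt X hXB)] at h1
      rwa [← h1]

theorem query_wp (hp : Admissible σ r w) (hs : Params σ r w s) {A : ℕ} {B : Set ℕ}
    (hA : A < σ ^ r) (harg : s.reg rArg = A) (hB : Stores σ r w s.mem B fun X _ => X ∈ B)
    (hBlt : ∀ X ∈ B, X < σ ^ r)
    (hQ : ∀ t s', t ≤ 28 * r + 26 → Keeps s s' → s'.reg rShift ≤ r →
      (∀ X ∈ B, ∀ d < s'.reg rShift, X % σ ^ (r - d) ≠ A / σ ^ d) →
      (B.Nonempty → s'.reg rBlock ∈ B) →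
      s'.reg rBlock % σ ^ (r - s'.reg rShift) = A / σ ^ s'.reg rShift → Q t s') :
    WP w (arraySize σ r w) queryCmd Q s := by
  have hr := hp.one_le
  have hσ := hp.two_le
  simp only [queryCmd, WP.seq_iff, WP.copy_iff, State.reg_setReg, Fin.reduceEq, if_false, harg]
  refine fetch_wp hp ((hs.setReg _ (by decide)).setReg _ (by decide))
    (by simpa [State.reg_setReg] using hA) ?_
  intro t u
  simp only [State.reg_setReg, State.mem_setReg, Fin.reduceEq, if_true]
  set s₁ := ((((s.setReg rX A).setReg rIdx A).setReg rT t).setReg rU u).setReg rVal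
    (field (Nat.clog 2 σ) (perWord σ w) (s.mem 0) A) with hs₁
  have hk₁ : Keeps s s₁ := by
    rw [hs₁]
    repeat refine Keeps.setReg ?_ _ (by decide)
    exact Keeps.refl s
  have hval : s₁.reg rVal = field (Nat.clog 2 σ) (perWord σ w) (s.mem 0) A := by
    simp [hs₁, State.reg_setReg]
  have hmain : WP w (arraySize σ r w) (.ite rVal (.const rShift 0) searchCmd)
      (fun t s' => t ≤ 14 * r + 15 ∧ Keeps s s' ∧ ∃ l, Found σ r B A l s' ∧
        (B.Nonempty → ∃ X ∈ B, X % σ ^ l = s'.reg rX)) s₁ := by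
    rw [WP.ite_iff, hval]
    by_cases hmem : A ∈ B
    · rw [if_pos ((IsTrie.leaf_iff hB A hA).2 hmem), WP.const_iff]
      have hx : s₁.reg rX = A := by simp [hs₁, State.reg_setReg]
      refine ⟨by omega, hk₁.setReg _ (by decide), r, ⟨le_rfl, ?_, ?_, ?_, ?_, ?_⟩,
        fun _ => ⟨A, hmem, ?_⟩⟩
      · simp [State.reg_setReg]
      · simp [State.reg_setReg, hx]
      · intro h; omega
      · intro h; omega
      · intro X _ d hd; omega
      · simp [State.reg_setReg, hx, Nat.mod_eq_of_lt hA]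
    · rw [if_neg fun h => hmem ((IsTrie.leaf_iff hB A hA).1 h)]
      refine search_wp hp (hk₁.params hs) hA (by simp [hs₁, State.reg_setReg, harg]) hmem hBlt
        (by rw [hk₁.mem]; exact hB) ?_
      intro t s' l ht hk hF hX
      exact ⟨by omega, hk₁.trans hk, l, hF, hX⟩
  refine hmain.mono ?_
  rintro t₂ s₂ ⟨ht₂, hk₂, l, hF, hX⟩
  have hk₃ : Keeps s (s₂.setReg rFlag (s₂.reg rShift)) := hk₂.setReg _ (by decide)
  refine extendLoop_wp (l := l) hp (hk₃.params hs) hA (by rw [hk₃.mem]; exact hB) hBlt ?_ ?_ ?_ ?_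
  · exact ⟨hF.le, hF.shift, hF.x, hF.pow, hF.off, hF.maximal⟩
  · exact hX
  · simp [State.reg_setReg, hF.shift]
  intro t₄ s₄ ht₄ hk₄ hsh hXB hxA
  have hle := hF.le
  have hshift : s₄.reg rShift = r - l := by
    rw [hsh]
    simp [State.reg_setReg, hF.shift]
  refine hQ _ _ (by omega) ((hk₃.trans hk₄).setReg _ (by decide)) ?_ ?_ ?_ ?_
  · simp [State.reg_setReg, hshift]
  · simpa [State.reg_setReg, hshift] using hF.maximal
  · simpa [State.reg_setReg] using hXB
  · simpa [State.reg_setReg, hshift, show r - (r - l) = l by omega] using hxA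

theorem query_invariant (hp : Admissible σ r w) {S : Fin N → Fin σ} {k : ℕ} (hk : k ≤ N)
    (h : Invariant σ r w S k s) (A : Fin r → Fin σ) :
    WP w (arraySize σ r w) queryCmd
      (fun t s' => t ≤ 28 * r + 26 ∧ Invariant σ r w S k s' ∧
        (r ≤ k → ∃ A' : Fin r → Fin σ, IsBlock S k A' ∧ s'.reg rBlock = code A' ∧
          ShiftMatch A' A (s'.reg rShift) ∧ (s'.reg rShift : ℕ∞) ≤ minOffset S k A))
      (s.setReg rArg (code A)) := by
  refine query_wp hp (h.params.setReg _ (by decide)) (code_lt A) (by simp [State.reg_setReg])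
    h.trie (fun X hX => blockCodes_lt hX) ?_
  intro t s' ht hkeep hle hmax hmem hmatch
  have hkeep' : Keeps s s' := ((Keeps.refl s).setReg _ (by decide)).trans hkeep
  refine ⟨ht, ⟨hkeep'.params h.params, ?_, ?_, ?_⟩, fun hrk => ?_⟩
  · rw [hkeep'.reg _ (by decide), h.cur]
  · rw [hkeep'.reg _ (by decide), h.cnt]
  · rw [hkeep'.mem]; exact h.trie
  · obtain ⟨A', hA', hcode⟩ := hmem (blockCodes_nonempty S hk hrk)
    refine ⟨A', hA', hcode, shiftMatch_of_code (by rw [← hcode]; exact hmatch), ?_⟩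
    refine le_iInf₂ fun l hl => ?_
    obtain ⟨X, hX, hXA⟩ := exists_block_of_occursAt hp.base_pos hp.one_le hk hl.1 hl.2
    rw [Nat.cast_le]
    -- An occurrence with a smaller offset would give a block matching a longer prefix of `A`,
    -- against maximality.
    by_contra hlt
    exact hmax X hX (l % r) (by omega) hXA

theorem reach_invariant (hp : Admissible σ r w) {S : Fin N → Fin σ} {k T : ℕ}
    (h : trieStructure.Reach w (arraySize σ r w) r S k s T) :
    k ≤ N ∧ Invariant σ r w S k s ∧
      T ≤ 5 * r + 5 * Nat.clog 2 σ + 8 + k * (27 * r + 23) := by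
  induction h with
  | setup h =>
    obtain ⟨h1, h2⟩ := (setup_invariant hp S).of_exec h
    exact ⟨Nat.zero_le _, h2, by omega⟩
  | append hs hk h ih =>
    obtain ⟨-, ih1, ih2⟩ := ih
    obtain ⟨h1, h2⟩ := (append_invariant hp hk ih1).of_exec h
    refine ⟨hk, h2, ?_⟩
    rw [add_mul]
    omega
  | query hs A h ih =>
    obtain ⟨ih0, ih1, ih2⟩ := ih
    obtain ⟨-, h2, -⟩ := (query_invariant hp ih0 ih1 A).of_exec h
    exact ⟨ih0, h2, ih2⟩

/-! ### Resource bounds -/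

theorem one_le_logb (hσ : 2 ≤ σ) : 1 ≤ Real.logb 2 σ := by
  rw [Real.le_logb_iff_rpow_le (by norm_num) (by positivity), Real.rpow_one]
  exact_mod_cast hσ

/-- Rounding up adds at most `1`, and `1 ≤ log₂ σ`. -/
theorem clog_le_logb (hσ : 2 ≤ σ) : (Nat.clog 2 σ : ℝ) ≤ 2 * Real.logb 2 σ := by
  have h1 := one_le_logb hσ
  have h2 : 2 ^ (Nat.clog 2 σ - 1) < σ := Nat.pow_pred_clog_lt_self (by norm_num) hσ
  have h3 : ((Nat.clog 2 σ - 1 : ℕ) : ℝ) ≤ Real.logb 2 σ := by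
    rw [Real.le_logb_iff_rpow_le (by norm_num) (by positivity), Real.rpow_natCast]
    exact_mod_cast h2.le
  have h4 : (Nat.clog 2 σ : ℝ) ≤ ((Nat.clog 2 σ - 1 : ℕ) : ℝ) + 1 := by
    exact_mod_cast (by omega : Nat.clog 2 σ ≤ Nat.clog 2 σ - 1 + 1)
  linarith

theorem logb_pow_eq (σ r : ℕ) : Real.logb 2 ((σ ^ r : ℕ) : ℝ) = r * Real.logb 2 σ := by
  rw [Nat.cast_pow, Real.logb_pow]

theorem spaceBits_le (hp : Admissible σ r w) :
    (spaceBits 26 w (arraySize σ r w) : ℝ) ≤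
      100 * (((σ ^ r : ℕ) : ℝ) * Real.logb 2 σ + w) := by
  -- The unused remainder of a word is shorter than one field, and at least one field fits, so at
  -- least half of each word is used.
  have h1 : w ≤ 2 * perWord σ w * Nat.clog 2 σ := by
    have h2 := Nat.lt_div_mul_add (a := w) hp.bits_pos
    have h3 : 1 * Nat.clog 2 σ ≤ perWord σ w * Nat.clog 2 σ :=
      Nat.mul_le_mul_right _ hp.perWord_pos
    rw [← perWord] at h2
    rw [mul_assoc]
    omega
  have h4 : σ ^ r / perWord σ w * w ≤ 2 * (σ ^ r * Nat.clog 2 σ) := by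
    calc σ ^ r / perWord σ w * w
        ≤ σ ^ r / perWord σ w * (2 * perWord σ w * Nat.clog 2 σ) := Nat.mul_le_mul_left _ h1
      _ = 2 * ((σ ^ r / perWord σ w * perWord σ w) * Nat.clog 2 σ) := by ring
      _ ≤ 2 * (σ ^ r * Nat.clog 2 σ) :=
        Nat.mul_le_mul_left _ (Nat.mul_le_mul_right _ (Nat.div_mul_le_self _ _))
  have h5 : spaceBits 26 w (arraySize σ r w) ≤ 6 * (σ ^ r * Nat.clog 2 σ) + 29 * w := by
    -- The `29` words are the `26` registers and the one extra word in each of the three arrays.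
    have : spaceBits 26 w (arraySize σ r w) = 3 * (σ ^ r / perWord σ w * w) + 29 * w := by
      simp only [spaceBits, arraySize, Finset.sum_const, Finset.card_univ, Fintype.card_fin,
        smul_eq_mul]
      ring
    omega
  have h6 : (spaceBits 26 w (arraySize σ r w) : ℝ) ≤
      6 * (((σ ^ r : ℕ) : ℝ) * Nat.clog 2 σ) + 29 * w := by exact_mod_cast h5
  have h7 := mul_le_mul_of_nonneg_left (clog_le_logb hp.two_le)
    (Nat.cast_nonneg (α := ℝ) (σ ^ r))
  have h8 : 0 ≤ ((σ ^ r : ℕ) : ℝ) * Real.logb 2 σ :=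
    mul_nonneg (Nat.cast_nonneg _) (by linarith [one_le_logb hp.two_le])
  have h9 : (0 : ℝ) ≤ w := Nat.cast_nonneg _
  linarith

theorem length_le_logb (hp : Admissible σ r w) : (r : ℝ) ≤ Real.logb 2 ((σ ^ r : ℕ) : ℝ) := by
  rw [logb_pow_eq]
  exact le_mul_of_one_le_right (Nat.cast_nonneg _) (one_le_logb hp.two_le)

theorem queryTime_le (hp : Admissible σ r w) {t : ℕ} (ht : t ≤ 28 * r + 26) :
    (t : ℝ) ≤ 100 * Real.logb 2 ((σ ^ r : ℕ) : ℝ) := by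
  have h1 := length_le_logb hp
  have h2 : (1 : ℝ) ≤ r := by exact_mod_cast hp.one_le
  have h3 : (t : ℝ) ≤ 28 * r + 26 := by exact_mod_cast ht
  linarith

theorem updateTime_le (hp : Admissible σ r w) {k T : ℕ} (hk : k ≤ σ ^ r)
    (hT : T ≤ 5 * r + 5 * Nat.clog 2 σ + 8 + k * (27 * r + 23)) :
    (T : ℝ) ≤ 100 * (((σ ^ r : ℕ) : ℝ) * Real.logb 2 ((σ ^ r : ℕ) : ℝ)) := by
  have h1 := length_le_logb hp
  have h2 : (1 : ℝ) ≤ r := by exact_mod_cast hp.one_le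
  have h3 : (Nat.clog 2 σ : ℝ) ≤ 2 * Real.logb 2 ((σ ^ r : ℕ) : ℝ) := by
    refine (clog_le_logb hp.two_le).trans ?_
    rw [logb_pow_eq]
    have := one_le_logb hp.two_le
    nlinarith
  have h4 : T ≤ σ ^ r * (32 * r + 5 * Nat.clog 2 σ + 31) := by
    have h5 : k * (27 * r + 23) ≤ σ ^ r * (27 * r + 23) := Nat.mul_le_mul_right _ hk
    have h6 : 1 * (5 * r + 5 * Nat.clog 2 σ + 8) ≤ σ ^ r * (5 * r + 5 * Nat.clog 2 σ + 8) :=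
      Nat.mul_le_mul_right _ (Nat.pow_pos hp.base_pos)
    have h7 : σ ^ r * (32 * r + 5 * Nat.clog 2 σ + 31) =
        σ ^ r * (5 * r + 5 * Nat.clog 2 σ + 8) + σ ^ r * (27 * r + 23) := by ring
    omega
  have h8 : (T : ℝ) ≤ ((σ ^ r : ℕ) : ℝ) * (32 * r + 5 * Nat.clog 2 σ + 31) := by exact_mod_cast h4
  refine h8.trans ?_
  rw [mul_left_comm]
  exact mul_le_mul_of_nonneg_left (by linarith) (Nat.cast_nonneg _)

end

end MetaBlock

/-- The program and the constant are uniform in `σ`, `N`, the word size `w ≥ log₂ N` and `S`.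
A machine with words of `w` bits has at least one word, so the space bound for arbitrary word sizes
is `O(N log σ + w)` bits, registers included; it is `O(N log σ)` bits as soon as `w = O(log N)`,
because `log N ≤ N log σ`. -/
theorem lemma8 :
    ∃ (m a : ℕ) (D : MetaBlock.OnlineStructure m a) (C : ℝ),
      ∀ (σ r N w : ℕ), 2 ≤ σ → 1 ≤ r → N = σ ^ r → N ≤ 2 ^ w →
        ∃ size : Fin a → ℕ,
          -- space
          (MetaBlock.spaceBits m w size : ℝ) ≤ C * (N * Real.logb 2 σ + w) ∧
          ∀ S : Fin N → Fin σ,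
            -- the structure can be set up
            (∃ t s, WordRAM.Exec w size D.setup (D.start σ r w) t s) ∧
            ∀ (k : ℕ) (s : WordRAM.State m a) (T : ℕ), D.Reach w size r S k s T →
              -- total maintenance time
              (T : ℝ) ≤ C * (N * Real.logb 2 N) ∧
              -- the next character can be appended
              (∀ hk : k < N, ∃ t s',
                WordRAM.Exec w size D.append (s.setReg D.charReg (S ⟨k, hk⟩ : ℕ)) t s') ∧
              -- queries
              (∀ A : Fin r → Fin σ, ∃ t s',
                WordRAM.Exec w size D.query (s.setReg D.argReg (MetaBlock.code A)) t s' ∧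
                (t : ℝ) ≤ C * Real.logb 2 N ∧
                (r ≤ k → ∃ A' : Fin r → Fin σ,
                  MetaBlock.IsBlock S k A' ∧
                  s'.reg D.blockReg = MetaBlock.code A' ∧
                  MetaBlock.ShiftMatch A' A (s'.reg D.shiftReg) ∧
                  (s'.reg D.shiftReg : ℕ∞) ≤ MetaBlock.minOffset S k A)) := by
  -- The constant `100` covers the estimates: `29` for space, `73` for maintenance and `54` for a
  -- query.
  refine ⟨26, 3, MetaBlock.trieStructure, 100, ?_⟩
  rintro σ r N w hσ hr rfl hw
  have hp : MetaBlock.Admissible σ r w := ⟨hσ, hr, hw⟩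
  refine ⟨MetaBlock.arraySize σ r w, MetaBlock.spaceBits_le hp, fun S => ⟨?_, ?_⟩⟩
  · obtain ⟨t, s, h, -⟩ := MetaBlock.setup_invariant hp S
    exact ⟨t, s, h⟩
  · intro k s T hR
    obtain ⟨hk, hI, hT⟩ := MetaBlock.reach_invariant hp hR
    refine ⟨MetaBlock.updateTime_le hp hk hT, fun hk' => ?_, fun A => ?_⟩
    · obtain ⟨t, s', h, -⟩ := MetaBlock.append_invariant hp hk' hI
      exact ⟨t, s', h⟩
    · obtain ⟨t, s', h, ht, -, hA⟩ := MetaBlock.query_invariant hp hk hI A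
      exact ⟨t, s', h, MetaBlock.queryTime_le hp ht, hA⟩
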